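/- **Theorem (Oblique Extension Principle).** Let $n\ge 1$ and $N\ge 0$ be integers, and let $A:\mathbb R^n\to\mathbb R^n$ be an expansive linear map (all its complex eigenvalues have modulus $>1$) with $A(\mathbb Z^n)\subset\mathbb Z^n$. Let $A^*$ be its adjoint, $d_A=|\det A|$, and let $\Gamma_{A^*}$, with $\mathbf 0\in\Gamma_{A^*}$, be a full collection of representatives of the cosets of $(A^*)^{-1}\mathbb Z^n/\mathbb Z^n$. Write $\widehat f(\mathbf x)=\int_{\mathbb R^n} f(\mathbf t)e^{-2\pi i\,\mathbf t\cdot\mathbf x}\,d\mathbf t$ for the Fourier transform, extended as usual to $L^2(\mathbb R^n)$. Functions in $L^\infty(\mathbb T^n)$, $\mathbb T^n=\mathbb R^n/\mathbb Z^n$, are regarded as $\mathbb Z^n$-periodic functions on $\mathbb R^n$. Let $\phi\in L^2(\mathbb R^n)$ satisfy $\widehat\phi(A^*\mathbf t)=H_0(\mathbf t)\,\widehat\phi(\mathbf t)$ for a.e. $\mathbf t$, where $H_0\in L^\infty(\mathbb T^n)$. Let $H_1,\dots,H_N\in L^\infty(\mathbb T^n)$ and let $\psi_1,\dots,\psi_N\in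 L^2(\mathbb R^n)$ be defined by $$\widehat{\psi_\ell}(A^*\mathbf t)=H_\ell(\mathbf t)\,\widehat\phi(\mathbf t)\quad\text{a.e.},\qquad \ell=1,\dots,N.$$ Put $\mathcal N_{\widehat\phi}=\{\mathbf t\in\mathbb R^n:\sum_{\mathbf k\in\mathbb Z^n}|\widehat\phi(\mathbf t+\mathbf k)|^2=0\}$. Assume that there is a non-negative $\mathbb Z^n$-periodic measurable function $S$ on $\mathbb R^n$ with $\sqrt S\,|\widehat\phi|\in L^2(\mathbb R^n)$ such that: (a) the origin is a point of $A^*$-approximate continuity of $S|\widehat\phi|^2$ when the value of this function at the origin is set to be $1$; that is, there is a Lebesgue measurable set $E\subset\mathbb R^n$ with $|E|>0$ such that $$\lim_{j\to\infty}\frac{|E\cap (A^*)^{-j}B_r|}{|(A^*)^{-j}B_r|}=1\quad\text{for every } r>0,\ \text{ where } B_r=\{\mathbf x\in\mathbb R^n:|\mathbf x|<r\},$$ and $S(\mathbf y)|\widehat\phi(\mathbf y)|^2\to 1$ as $\mathbf y\to\mathbf 0$, $\mathbf y\in E\setminus\{\mathbf 0\}$; (b) $S(A^*\mathbf t)|H_0(\mathbf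 t)|^2+\sum_{\ell=1}^N|H_\ell(\mathbf t)|^2=S(\mathbf t)$ for a.e. $\mathbf t\in\mathbb R^n\setminus\mathcal N_{\widehat\phi}$; (c) for every $\mathbf p\in\Gamma_{A^*}\setminus\{\mathbf 0\}$, the equality $$S(A^*\mathbf t)H_0(\mathbf t)\overline{H_0(\mathbf t+\mathbf p)}+\sum_{\ell=1}^N H_\ell(\mathbf t)\overline{H_\ell(\mathbf t+\mathbf p)}=0$$ holds for a.e. $\mathbf t\in\mathbb R^n\setminus\mathcal N_{\widehat\phi}$ such that $\mathbf t+\mathbf p\in\mathbb R^n\setminus\mathcal N_{\widehat\phi}$. Then $\{\psi_1,\dots,\psi_N\}$ is a Parseval wavelet frame for $L^2(\mathbb R^n)$: with $\psi_{\ell,j,\mathbf k}(\mathbf t)=d_A^{j/2}\,\psi_\ell(A^j\mathbf t-\mathbf k)$, $$\sum_{\ell=1}^N\sum_{j\in\mathbb Z}\sum_{\mathbf k\in\mathbb Z^n}|\langle f,\psi_{\ell,j,\mathbf k}\rangle|^2=\|f\|_2^2\qquad\text{for all } f\in L^2(\mathbb R^n).$$ -/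

import Mathlib

open MeasureTheory Filter Topology FourierTransform
open scoped ENNReal ComplexConjugate

noncomputable section

namespace OEP

/-- The space `ℝⁿ` with its Euclidean structure. -/
abbrev Euc (n : ℕ) : Type := EuclideanSpace ℝ (Fin n)

/-- The Hilbert space `L²(ℝⁿ)` of complex valued functions. -/
abbrev L2 (n : ℕ) : Type := Lp (α := Euc n) ℂ 2 volume

/-- The Fourier transform of `f ∈ L²(ℝⁿ)`, normalised by `f̂(x) = ∫ f(t) e^{-2πi t·x} dt` for
integrable `f` and extended to `L²` by continuity. -/
def ft {n : ℕ} (f : L2 n) : Euc n → ℂ := ⇑(𝓕 f : L2 n)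

/-- The integer vector `k ∈ ℤⁿ`, seen in `ℝⁿ`. -/
def latt {n : ℕ} (k : Fin n → ℤ) : Euc n := WithLp.toLp 2 (fun i => (k i : ℝ))

/-- The lattice `ℤⁿ` as a subset of `ℝⁿ`. -/
def intLattice (n : ℕ) : Set (Euc n) := Set.range (latt (n := n))

/-- A linear map is expansive if all its complex eigenvalues, that is, all eigenvalues of its
complexification, have absolute value greater than `1`. -/
def IsExpansive {n : ℕ} (A : Euc n →L[ℝ] Euc n) : Prop :=
  ∀ z : ℂ, Module.End.HasEigenvalue ((A : Euc n →ₗ[ℝ] Euc n).baseChange ℂ) z → 1 < ‖z‖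

/-- The adjoint `A*`. -/
def adj {n : ℕ} (A : Euc n ≃L[ℝ] Euc n) : Euc n →L[ℝ] Euc n :=
  ContinuousLinearMap.adjoint (A : Euc n →L[ℝ] Euc n)

/-- `d_A = |det A|`. -/
def absDet {n : ℕ} (A : Euc n ≃L[ℝ] Euc n) : ℝ := |LinearMap.det (A : Euc n →ₗ[ℝ] Euc n)|

/-- `Γ` is a full collection of representatives, containing `0`, of the cosets of
`B⁻¹ℤⁿ / ℤⁿ`. -/
def IsCosetReps {n : ℕ} (B : Euc n →L[ℝ] Euc n) (Γ : Set (Euc n)) : Prop :=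
  0 ∈ Γ ∧ (∀ p ∈ Γ, B p ∈ intLattice n) ∧
    ∀ q : Euc n, B q ∈ intLattice n → ∃! p : Euc n, p ∈ Γ ∧ q - p ∈ intLattice n

/-- `ℤⁿ`-periodicity, understood (as all identities between functions) almost everywhere. -/
def IsPeriodic {n : ℕ} {X : Type*} (F : Euc n → X) : Prop :=
  ∀ k : Fin n → ℤ, ∀ᵐ t ∂(volume : Measure (Euc n)), F (t + latt k) = F t

/-- `F ∈ L^∞(𝕋ⁿ)`, seen as an essentially bounded `ℤⁿ`-periodic function on `ℝⁿ`. -/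
def MemLInftyTorus {n : ℕ} (F : Euc n → ℂ) : Prop :=
  IsPeriodic F ∧ MemLp F ∞ (volume : Measure (Euc n))

/-- The bracket `[g, g](t) = ∑_{k ∈ ℤⁿ} |g(t + k)|²`, with values in `[0, ∞]`. -/
def bracket {n : ℕ} (g : Euc n → ℂ) (t : Euc n) : ℝ≥0∞ :=
  ∑' k : Fin n → ℤ, ‖g (t + latt k)‖ₑ ^ 2

/-- The zero set `𝒩_g` of the bracket. -/
def bracketZeros {n : ℕ} (g : Euc n → ℂ) : Set (Euc n) := {t | bracket g t = 0}

/-- The set `B^{-j} B_r + x`. -/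
def shrunkBall {n : ℕ} (B : Euc n →L[ℝ] Euc n) (j : ℕ) (r : ℝ) (x : Euc n) : Set (Euc n) :=
  {y | (B ^ j) (y - x) ∈ Metric.ball (0 : Euc n) r}

/-- `x` is a point of `B`-density for the Lebesgue measurable set `E` of positive measure. -/
def IsDensityPoint {n : ℕ} (B : Euc n →L[ℝ] Euc n) (E : Set (Euc n)) (x : Euc n) : Prop :=
  NullMeasurableSet E volume ∧ 0 < volume E ∧ ∀ r : ℝ, 0 < r →
    Tendsto (fun j : ℕ => volume (E ∩ shrunkBall B j r x) / volume (shrunkBall B j r 0))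
      atTop (𝓝 1)

/-- `x` is a point of `B`-approximate continuity of `f`. -/
def IsApproxContinuityPoint {n : ℕ} {X : Type*} [TopologicalSpace X]
    (B : Euc n →L[ℝ] Euc n) (f : Euc n → X) (x : Euc n) : Prop :=
  ∃ E : Set (Euc n), IsDensityPoint B E x ∧ Tendsto f (𝓝[E] x) (𝓝 (f x))

/-- The translation `τ_b f (t) = f (t - b)` on `L²(ℝⁿ)`. -/
def translation {n : ℕ} (b : Euc n) (f : L2 n) : L2 n :=
  Lp.compMeasurePreserving (fun t : Euc n => t - b) (measurePreserving_sub_right volume b) f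

theorem memLp_dilation {n : ℕ} (A : Euc n ≃L[ℝ] Euc n) (f : L2 n) :
    MemLp (fun t : Euc n => ((Real.sqrt (absDet A) : ℝ) : ℂ) * f (A t)) 2 volume := by
  have hdet : LinearMap.det (A : Euc n →ₗ[ℝ] Euc n) ≠ 0 :=
    (LinearEquiv.isUnit_det' A.toLinearEquiv).ne_zero
  have hmap : MemLp f 2 (Measure.map (fun t : Euc n => A t) volume) := by
    have h := Measure.map_linearMap_addHaar_eq_smul_addHaar (volume : Measure (Euc n)) hdet
    have h' : Measure.map (fun t : Euc n => A t) volume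
        = ENNReal.ofReal |(LinearMap.det (A : Euc n →ₗ[ℝ] Euc n))⁻¹| • volume := h
    rw [h']
    exact (Lp.memLp f).smul_measure ENNReal.ofReal_ne_top
  exact (hmap.comp_of_map A.continuous.measurable.aemeasurable).const_mul _

/-- The dilation `D_A f (t) = d_A^{1/2} f (A t)` on `L²(ℝⁿ)`. -/
def dilation {n : ℕ} (A : Euc n ≃L[ℝ] Euc n) (f : L2 n) : L2 n :=
  (memLp_dilation A f).toLp _

/-- `D_A D_B = D_{BA}`; in particular `D_{A^j}` is the `j`-th power of `D_A` for all `j ∈ ℤ`. -/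
theorem dilation_dilation {n : ℕ} (A B : Euc n ≃L[ℝ] Euc n) (f : L2 n) :
    dilation A (dilation B f) = dilation (B * A) f := by
  have hdet : LinearMap.det (A : Euc n →ₗ[ℝ] Euc n) ≠ 0 :=
    (LinearEquiv.isUnit_det' A.toLinearEquiv).ne_zero
  have hq : Measure.QuasiMeasurePreserving (fun t : Euc n => A t) volume volume := by
    refine ⟨A.continuous.measurable, ?_⟩
    have h := Measure.map_linearMap_addHaar_eq_smul_addHaar (volume : Measure (Euc n)) hdet
    have h' : Measure.map (fun t : Euc n => A t) volume
        = ENNReal.ofReal |(LinearMap.det (A : Euc n →ₗ[ℝ] Euc n))⁻¹| • volume := h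
    rw [h']
    exact Measure.smul_absolutelyContinuous
  have hmul : absDet (B * A) = absDet A * absDet B := by
    have h : ((B * A : Euc n ≃L[ℝ] Euc n) : Euc n →ₗ[ℝ] Euc n)
        = (B : Euc n →ₗ[ℝ] Euc n) ∘ₗ (A : Euc n →ₗ[ℝ] Euc n) := rfl
    unfold absDet
    rw [h, LinearMap.det_comp, abs_mul, mul_comm]
  apply Lp.ext
  filter_upwards [(memLp_dilation A (dilation B f)).coeFn_toLp,
    (memLp_dilation (B * A) f).coeFn_toLp,
    hq.ae (memLp_dilation B f).coeFn_toLp] with t h1 h2 h3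
  have e1 : dilation A (dilation B f) t
      = ((Real.sqrt (absDet A) : ℝ) : ℂ) * dilation B f (A t) := h1
  have e2 : dilation (B * A) f t
      = ((Real.sqrt (absDet (B * A)) : ℝ) : ℂ) * f (B (A t)) := h2
  have e3 : dilation B f (A t) = ((Real.sqrt (absDet B) : ℝ) : ℂ) * f (B (A t)) := h3
  rw [e1, e2, e3, hmul, Real.sqrt_mul (show 0 ≤ absDet A from abs_nonneg _)]
  push_cast
  ring

/-- The affine system `D_A^j τ_k ψ_ℓ`, `j ∈ ℤ`, `k ∈ ℤⁿ`, `1 ≤ ℓ ≤ N`. -/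
def affineSystem {n N : ℕ} (A : Euc n ≃L[ℝ] Euc n) (ψ : Fin N → L2 n) :
    Fin N × ℤ × (Fin n → ℤ) → L2 n :=
  fun i => dilation (A ^ i.2.1) (translation (latt i.2.2) (ψ i.1))

/-- A family `e` in a Hilbert space is a Parseval frame (a frame with both bounds equal to `1`) if
`∑ᵢ |⟨h, eᵢ⟩|² = ‖h‖²` for all `h`. -/
def IsParsevalFrame {ι H : Type*} [NormedAddCommGroup H] [InnerProductSpace ℂ H]
    (e : ι → H) : Prop :=
  ∀ h : H, HasSum (fun i => ‖inner ℂ (e i) h‖ ^ 2) (‖h‖ ^ 2)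

/-- `{ψ_1, …, ψ_N}` is a Parseval wavelet frame associated to the dilation `A`. -/
def IsParsevalWaveletFrame {n N : ℕ} (A : Euc n ≃L[ℝ] Euc n) (ψ : Fin N → L2 n) : Prop :=
  IsParsevalFrame (affineSystem A ψ)

end OEP

end

noncomputable section

namespace OEP

/-! ### The integer lattice, its half-open fundamental cube, and unfolding of integrals. -/

section Lattice

variable {n : ℕ}

/-! Everything happens on the Fourier side, with `B = A*`. For bounded measurable `G` with bounded
support, let `[G, χ](t) = ∑ₖ G(t + k) conj χ(t + k)` (`correlation`), and let `E(G) = ∫_Q S |[G,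
φ̂]|²` over the unit cube (`energy`). Write `D_M` for the unitary dilation `dilFun M` and `g` for
`f̂`.

The coefficients of `f` against `D_A^j τ_k ψ_ℓ` are the Fourier coefficients of `[D_{B^j} g, ψ̂_ℓ]`
(`inner_dilation_translation`), so by Parseval on the torus their squares add up over `k` to `∫_Q
|[D_{B^j} g, ψ̂_ℓ]|²` (`tsum_enorm_sq_integral_expo`). Splitting `ℤⁿ` into the cosets `B(p + ℤⁿ)`,
`p ∈ Γ`, the refinement equations express the correlations of `D_{B⁻¹} G` with `φ̂` and `ψ̂_ℓ`
through the values of `[G, φ̂]` at the points `s + p`. Conditions (b) and (c) say that the resulting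
quadratic form is diagonal with entries `S(s + p)`; integration gives `E(D_{B⁻¹} G) + ∑_ℓ ∫_Q
|[D_{B⁻¹} G, ψ̂_ℓ]|² = E(G)` (`MaskSystem.energy_step`). Hence the sum over all scales telescopes,
and only the limits of `E(D_{B^j} g)` matter.

As `j → ∞` the support of `D_{B^j} g` shrinks into a ball where lattice translates do not interact,
and `E(D_{B^j} g) = ∫ |g|² (S|φ̂|²)(B^{-j} ·)`. By (b) the factor `(S|φ̂|²)(B^{-j} ·)` increases
with `j`; by (a) it tends to `1` in measure on balls, hence almost everywhere, and monotone
convergence yields `‖f‖²` (`MaskSystem.tendsto_energy_atTop`).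

As `j → -∞`, Cauchy-Schwarz bounds `E(D_{B^j} g)` by a constant times the integral of `S|φ̂|²` over
the set where `D_{B^j} g ≠ 0`. If `g` vanishes near the origin this set escapes to infinity, and
integrability of `S|φ̂|²` gives the limit `0` (`MaskSystem.tendsto_energy_atBot`). Such `g` are
dense, and a Parseval identity on a dense set extends (`isParsevalFrame_of_dense`). Sums and
energies live in `[0, ∞]`, so no finiteness has to be checked in the telescoping. -/

@[simp] theorem latt_apply (k : Fin n → ℤ) (i : Fin n) : latt k i = (k i : ℝ) := rfl

@[simp] theorem latt_zero : latt (0 : Fin n → ℤ) = 0 := by ext i; simp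

theorem latt_add (k m : Fin n → ℤ) : latt (k + m) = latt k + latt m := by ext i; simp

theorem latt_neg (k : Fin n → ℤ) : latt (-k) = -latt k := by ext i; simp

theorem latt_sub (k m : Fin n → ℤ) : latt (k - m) = latt k - latt m := by ext i; simp

theorem latt_injective : Function.Injective (latt (n := n)) := by
  intro k m h
  ext i
  have := congrArg (fun x : Euc n => x i) h
  simpa using this

/-- The half-open unit cube `(0, 1]ⁿ`. -/
def unitCube (n : ℕ) : Set (Euc n) := {t | ∀ i, t i ∈ Set.Ioc (0 : ℝ) 1}

theorem measurableSet_unitCube : MeasurableSet (unitCube n) := by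
  have : unitCube n = ⋂ i, (fun t : Euc n => t i) ⁻¹' Set.Ioc (0 : ℝ) 1 := by
    ext t; simp [unitCube]
  rw [this]
  exact MeasurableSet.iInter fun i =>
    (by fun_prop : Measurable fun t : Euc n => t i) measurableSet_Ioc

theorem exists_sub_latt_mem_unitCube (t : Euc n) : ∃ k, t - latt k ∈ unitCube n := by
  -- The cube is open on the left and closed on the right, hence `⌈x⌉ - 1` instead of `⌊x⌋`.
  refine ⟨fun i => ⌈t i⌉ - 1, fun i => ?_⟩
  have h1 := Int.le_ceil (t i)
  have h2 := Int.ceil_lt_add_one (t i)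
  simp only [PiLp.sub_apply, latt_apply, Int.cast_sub, Int.cast_one]
  constructor <;> linarith

theorem eq_of_sub_latt_mem_unitCube {t : Euc n} {k m : Fin n → ℤ} (hk : t - latt k ∈ unitCube n)
    (hm : t - latt m ∈ unitCube n) : k = m := by
  ext i
  have h1 := hk i
  have h2 := hm i
  simp only [PiLp.sub_apply, latt_apply, Set.mem_Ioc] at h1 h2
  have a : (k i : ℝ) < m i + 1 := by linarith [h1.1, h2.2]
  have b : (m i : ℝ) < k i + 1 := by linarith [h1.2, h2.1]
  have a' : k i < m i + 1 := by exact_mod_cast a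
  have b' : m i < k i + 1 := by exact_mod_cast b
  omega

theorem finite_norm_latt_le (R : ℝ) : {k : Fin n → ℤ | ‖latt k‖ ≤ R}.Finite := by
  refine (Set.finite_Icc (fun _ : Fin n => -⌈R⌉) (fun _ : Fin n => ⌈R⌉)).subset fun k hk => ?_
  have h (i : Fin n) : |(k i : ℝ)| ≤ ⌈R⌉ := by
    have := (PiLp.norm_apply_le (latt k) i).trans (hk.trans (Int.le_ceil R))
    simpa using this
  have h' (i : Fin n) : |k i| ≤ ⌈R⌉ := by exact_mod_cast h i
  exact ⟨fun i => (abs_le.1 (h' i)).1, fun i => (abs_le.1 (h' i)).2⟩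

theorem norm_le_of_mem_unitCube {t : Euc n} (ht : t ∈ unitCube n) : ‖t‖ ≤ n := by
  have h1 : ‖t‖ ^ 2 ≤ (n : ℝ) ^ 2 := by
    rw [EuclideanSpace.norm_sq_eq]
    calc ∑ i, ‖t i‖ ^ 2 ≤ ∑ _i : Fin n, (1 : ℝ) := by
          refine Finset.sum_le_sum fun i _ => ?_
          have := ht i
          rw [Real.norm_of_nonneg this.1.le]
          nlinarith [this.1, this.2]
      _ = n := by simp
      _ ≤ (n : ℝ) ^ 2 := by
          exact_mod_cast Nat.le_self_pow (by norm_num) n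
  exact (sq_le_sq₀ (norm_nonneg _) (by positivity)).1 h1

theorem tsum_indicator_unitCube (t : Euc n) :
    ∑' k, (unitCube n).indicator (fun _ => (1 : ℝ≥0∞)) (t - latt k) = 1 := by
  obtain ⟨k, hk⟩ := exists_sub_latt_mem_unitCube t
  rw [tsum_eq_single k, Set.indicator_of_mem hk]
  intro m hm
  exact Set.indicator_of_notMem (fun h => hm (eq_of_sub_latt_mem_unitCube h hk)) _

/-- Unfolding: the integral of the periodization over the cube is the integral over `ℝⁿ`. -/
theorem lintegral_unitCube_tsum {f : Euc n → ℝ≥0∞} (hf : AEMeasurable f) :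
    ∫⁻ t in unitCube n, ∑' k, f (t + latt k) = ∫⁻ t, f t := by
  have hq (k : Fin n → ℤ) : AEMeasurable (fun t => f (t + latt k)) :=
    hf.comp_quasiMeasurePreserving
      (measurePreserving_add_right volume (latt k)).quasiMeasurePreserving
  rw [lintegral_tsum fun k => (hq k).restrict]
  calc ∑' k, ∫⁻ t in unitCube n, f (t + latt k)
      = ∑' k, ∫⁻ t, (unitCube n).indicator (fun _ => (1 : ℝ≥0∞)) (t - latt k) * f t := by
        refine tsum_congr fun k => ?_
        rw [← lintegral_indicator measurableSet_unitCube,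
          ← lintegral_add_right_eq_self (fun t => _ * f t) (latt k)]
        refine lintegral_congr fun t => ?_
        by_cases h : t ∈ unitCube n <;> simp [h]
    _ = ∫⁻ t, ∑' k, (unitCube n).indicator (fun _ => (1 : ℝ≥0∞)) (t - latt k) * f t := by
        rw [lintegral_tsum fun k => ?_]
        refine AEMeasurable.mul (Measurable.aemeasurable ?_) hf
        exact (measurable_const.indicator measurableSet_unitCube).comp
          (measurable_sub_const (latt k))
    _ = ∫⁻ t, f t := by
        simp_rw [ENNReal.tsum_mul_right, tsum_indicator_unitCube, one_mul]

/-- Complex-valued counterpart of the unfolding identity; a finite set of relevant translates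
replaces positivity in exchanging sum and integral. -/
theorem integral_eq_integral_unitCube_sum {f : Euc n → ℂ} (hf : Integrable f)
    (M : Finset (Fin n → ℤ)) (hM : ∀ t ∈ unitCube n, ∀ k ∉ M, f (t + latt k) = 0) :
    ∫ t, f t = ∫ t in unitCube n, ∑ k ∈ M, f (t + latt k) := by
  have key (t : Euc n) :
      f t = ∑ k ∈ M, (unitCube n).indicator (fun s => f (s + latt k)) (t - latt k) := by
    obtain ⟨k, hk⟩ := exists_sub_latt_mem_unitCube t
    by_cases hkM : k ∈ M
    · rw [Finset.sum_eq_single_of_mem k hkM, Set.indicator_of_mem hk, sub_add_cancel]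
      intro m _ hm
      exact Set.indicator_of_notMem (fun h => hm (eq_of_sub_latt_mem_unitCube h hk)) _
    · have h0 := hM _ hk k hkM
      rw [sub_add_cancel] at h0
      rw [h0, eq_comm]
      refine Finset.sum_eq_zero fun m hm => Set.indicator_of_notMem (fun h => ?_) _
      exact hkM (eq_of_sub_latt_mem_unitCube h hk ▸ hm)
  have hi (k : Fin n → ℤ) : Integrable fun t => f (t + latt k) := hf.comp_add_right _
  rw [integral_finsetSum _ fun k _ => (hi k).integrableOn]
  simp_rw [fun k => (integral_indicator (f := fun t => f (t + latt k)) (μ := volume)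
    (measurableSet_unitCube (n := n))).symm]
  conv_lhs => rw [integral_congr_ae (ae_of_all _ key)]
  rw [integral_finsetSum _ fun k _ => ?_]
  · refine Finset.sum_congr rfl fun k _ => ?_
    exact integral_sub_right_eq_self (fun s => (unitCube n).indicator
      (fun s => f (s + latt k)) s) (latt k)
  · exact ((hi k).indicator measurableSet_unitCube).comp_sub_right (latt k)

end Lattice

/-! ### Parseval's identity transported from the torus to the unit cube. -/

section Torus

variable {n : ℕ}

/-- The Haar measure on the unit circle, with the instance used by `UnitAddTorus.mFourierBasis`. -/
local instance : MeasureSpace UnitAddCircle := ⟨AddCircle.haarAddCircle⟩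

/-- The representative of a point of the torus in the unit cube. -/
def torusLift (x : UnitAddTorus (Fin n)) : Euc n :=
  WithLp.toLp 2 (UnitAddTorus.measurableEquivPiIoc (fun _ : Fin n => (0 : ℝ)) x).1

theorem coe_torusLift (x : UnitAddTorus (Fin n)) :
    (fun i => ((torusLift x i : ℝ) : UnitAddCircle)) = x :=
  (UnitAddTorus.measurableEquivPiIoc (fun _ : Fin n => (0 : ℝ))).symm_apply_apply x

theorem measurableSet_pi_Ioc :
    MeasurableSet {x : Fin n → ℝ | ∀ i, x i ∈ Set.Ioc (0 : ℝ) (0 + 1)} :=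
  MeasurableSet.univ_pi' fun _ => measurableSet_Ioc

theorem measurableEmbedding_torusLift : MeasurableEmbedding (torusLift (n := n)) :=
  (MeasurableEquiv.toLp 2 (Fin n → ℝ)).measurableEmbedding.comp
    ((MeasurableEmbedding.subtype_coe measurableSet_pi_Ioc).comp
      (UnitAddTorus.measurableEquivPiIoc (fun _ : Fin n => (0 : ℝ))).measurableEmbedding)

theorem measurePreserving_torusLift :
    MeasurePreserving (torusLift (n := n)) volume (volume.restrict (unitCube n)) := by
  have h1 := UnitAddTorus.measurePreserving_equivPiIoc (fun _ : Fin n => (0 : ℝ))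
  have h2 : MeasurePreserving
      (Subtype.val : {x : Fin n → ℝ // ∀ i, x i ∈ Set.Ioc (0 : ℝ) (0 + 1)} → Fin n → ℝ)
      (Measure.comap Subtype.val volume)
      (volume.restrict {x : Fin n → ℝ | ∀ i, x i ∈ Set.Ioc (0 : ℝ) (0 + 1)}) :=
    ⟨measurable_subtype_coe, map_comap_subtype_coe measurableSet_pi_Ioc _⟩
  have h3 := (PiLp.volume_preserving_toLp (Fin n)).restrict_preimage
    (measurableSet_unitCube (n := n))
  have e : (WithLp.toLp 2 : (Fin n → ℝ) → Euc n) ⁻¹' unitCube n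
      = {x : Fin n → ℝ | ∀ i, x i ∈ Set.Ioc (0 : ℝ) (0 + 1)} := by
    ext x; simp [unitCube]
  rw [e] at h3
  exact h3.comp (h2.comp h1)

theorem mFourier_torusLift (k : Fin n → ℤ) (x : UnitAddTorus (Fin n)) :
    UnitAddTorus.mFourier k x
      = Complex.exp (2 * Real.pi * Complex.I * (inner ℝ (latt k) (torusLift x) : ℝ)) := by
  conv_lhs => rw [← coe_torusLift x]
  simp only [UnitAddTorus.mFourier, ContinuousMap.coe_mk, fourier_coe_apply]
  rw [← Complex.exp_sum]
  congr 1
  simp only [PiLp.inner_apply, latt_apply, RCLike.inner_apply, conj_trivial]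
  push_cast
  rw [Finset.mul_sum]
  refine Finset.sum_congr rfl fun i _ => ?_
  ring

/-- Parseval's identity for square integrable functions on the unit cube. -/
theorem tsum_enorm_sq_integral_unitCube {w : Euc n → ℂ}
    (hw : MemLp w 2 (volume.restrict (unitCube n))) :
    ∑' k : Fin n → ℤ, ‖∫ t in unitCube n,
        Complex.exp (2 * Real.pi * Complex.I * (inner ℝ (latt k) t : ℝ)) * w t‖ₑ ^ 2
      = ∫⁻ t in unitCube n, ‖w t‖ₑ ^ 2 := by
  have hF : MemLp (w ∘ torusLift) 2 (volume : Measure (UnitAddTorus (Fin n))) :=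
    hw.comp_measurePreserving measurePreserving_torusLift
  have hs := UnitAddTorus.hasSum_sq_mFourierCoeff hF.toLp
  -- The coefficient of index `k` is taken against `e^{-2πi k·t}`, while frame coefficients carry
  -- the opposite sign; hence `-k` here and the reindexing by negation below.
  have hcoef (k : Fin n → ℤ) : UnitAddTorus.mFourierCoeff hF.toLp (-k) = ∫ t in unitCube n,
      Complex.exp (2 * Real.pi * Complex.I * (inner ℝ (latt k) t : ℝ)) * w t := by
    rw [← measurePreserving_torusLift.integral_comp measurableEmbedding_torusLift,
      UnitAddTorus.mFourierCoeff]
    refine integral_congr_ae ?_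
    filter_upwards [hF.coeFn_toLp] with x hx
    rw [neg_neg, hx, mFourier_torusLift, smul_eq_mul, Function.comp]
  have h2 : ∫⁻ t in unitCube n, ‖w t‖ₑ ^ 2
      = ENNReal.ofReal (∫ x, ‖(hF.toLp : UnitAddTorus (Fin n) → ℂ) x‖ ^ 2) := by
    rw [← measurePreserving_torusLift.lintegral_comp_emb measurableEmbedding_torusLift,
      ofReal_integral_eq_lintegral_ofReal]
    · refine lintegral_congr_ae ?_
      filter_upwards [hF.coeFn_toLp] with x hx
      rw [hx, ENNReal.ofReal_pow (norm_nonneg _), ofReal_norm, Function.comp]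
    · exact (Lp.memLp hF.toLp).integrable_norm_pow (by norm_num)
    · exact ae_of_all _ fun x => by positivity
  rw [h2, ← hs.tsum_eq, ENNReal.ofReal_tsum_of_nonneg (fun _ => by positivity) hs.summable,
    ← (Equiv.neg (Fin n → ℤ)).tsum_eq]
  refine tsum_congr fun k => ?_
  rw [← hcoef, ENNReal.ofReal_pow (norm_nonneg _), ofReal_norm]
  simp

end Torus

/-! ### Periodizations of functions with bounded support. -/

section Periodization

variable {n : ℕ}

/-- The periodization `t ↦ ∑ₖ v (t + k)`. -/
def periodization (v : Euc n → ℂ) (t : Euc n) : ℂ := ∑' k : Fin n → ℤ, v (t + latt k)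

theorem finite_ne_zero_add_latt {v : Euc n → ℂ} {R : ℝ} (hv : ∀ t, R < ‖t‖ → v t = 0)
    (t : Euc n) : {k : Fin n → ℤ | v (t + latt k) ≠ 0}.Finite := by
  refine (finite_norm_latt_le (R + ‖t‖)).subset fun k hk => ?_
  have h1 : ‖t + latt k‖ ≤ R := not_lt.1 fun h => hk (hv _ h)
  have h2 : ‖latt k‖ ≤ ‖t + latt k‖ + ‖t‖ := by
    simpa using norm_sub_le (t + latt k) t
  exact h2.trans (by linarith)

theorem summable_add_latt {v : Euc n → ℂ} {R : ℝ} (hv : ∀ t, R < ‖t‖ → v t = 0)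
    (t : Euc n) : Summable fun k : Fin n → ℤ => v (t + latt k) :=
  summable_of_hasFiniteSupport (finite_ne_zero_add_latt hv t)

theorem periodization_add_latt (v : Euc n → ℂ) (t : Euc n) (m : Fin n → ℤ) :
    periodization v (t + latt m) = periodization v t := by
  unfold periodization
  rw [← (Equiv.addLeft m).tsum_eq (fun k => v (t + latt k))]
  refine tsum_congr fun k => ?_
  rw [Equiv.coe_addLeft, latt_add, add_assoc]

/-- Only lattice vectors of norm at most `R + n` can move a point of the cube into the support. One
finite set thus serves the whole cube, and measurability and square integrability pass to the
periodization. -/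
theorem exists_finset_periodization {v : Euc n → ℂ} {R : ℝ} (hv : ∀ t, R < ‖t‖ → v t = 0) :
    ∃ M : Finset (Fin n → ℤ), (∀ t ∈ unitCube n, ∀ k ∉ M, v (t + latt k) = 0) ∧
      ∀ t ∈ unitCube n, periodization v t = ∑ k ∈ M, v (t + latt k) := by
  have h : ∀ t ∈ unitCube n, ∀ k ∉ (finite_norm_latt_le (n := n) (R + n)).toFinset,
      v (t + latt k) = 0 := by
    intro t ht k hk
    refine hv _ ?_
    simp only [Set.Finite.mem_toFinset, Set.mem_ofPred_eq, not_le] at hk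
    have h2 : ‖latt k‖ ≤ ‖t + latt k‖ + ‖t‖ := by
      simpa using norm_sub_le (t + latt k) t
    linarith [norm_le_of_mem_unitCube ht]
  exact ⟨_, h, fun t ht => tsum_eq_sum fun k hk => h t ht k hk⟩

/-- The exponential `e^{2πi k·t}`. -/
def expo (k : Fin n → ℤ) (t : Euc n) : ℂ :=
  Complex.exp (2 * Real.pi * Complex.I * (inner ℝ (latt k) t : ℝ))

theorem inner_latt_latt (k m : Fin n → ℤ) :
    inner ℝ (latt k) (latt m) = ((∑ i, k i * m i : ℤ) : ℝ) := by
  simp only [PiLp.inner_apply, latt_apply, RCLike.inner_apply, conj_trivial]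
  push_cast
  exact Finset.sum_congr rfl fun i _ => mul_comm _ _

theorem expo_add_latt (k m : Fin n → ℤ) (t : Euc n) : expo k (t + latt m) = expo k t := by
  unfold expo
  rw [inner_add_right, inner_latt_latt, Complex.exp_eq_exp_iff_exists_int]
  refine ⟨∑ i, k i * m i, ?_⟩
  push_cast
  ring

theorem continuous_expo (k : Fin n → ℤ) : Continuous (expo k) := by
  unfold expo; fun_prop

theorem norm_expo (k : Fin n → ℤ) (t : Euc n) : ‖expo k t‖ = 1 := by
  unfold expo
  rw [show 2 * (Real.pi : ℂ) * Complex.I * ((inner ℝ (latt k) t : ℝ) : ℂ)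
    = ((2 * Real.pi * inner ℝ (latt k) t : ℝ) : ℂ) * Complex.I by push_cast; ring]
  exact Complex.norm_exp_ofReal_mul_I _

theorem integrable_of_memLp_two_of_bounded_support {v : Euc n → ℂ} (hv2 : MemLp v 2) {R : ℝ}
    (hv : ∀ t, R < ‖t‖ → v t = 0) : Integrable v := by
  have h1 : MemLp v 2 (volume.restrict (Metric.closedBall (0 : Euc n) R)) := hv2.restrict _
  have : IsFiniteMeasure (volume.restrict (Metric.closedBall (0 : Euc n) R)) :=
    ⟨by simpa using measure_closedBall_lt_top⟩
  have h2 : IntegrableOn v (Metric.closedBall (0 : Euc n) R) := h1.integrable (by norm_num)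
  refine (integrableOn_iff_integrable_of_support_subset fun t ht => ?_).1 h2
  rw [mem_closedBall_zero_iff]
  exact not_lt.1 fun h => ht (hv t h)

/-- Parseval's identity for the Fourier coefficients of a square integrable function with bounded
support, at the lattice frequencies. -/
theorem tsum_enorm_sq_integral_expo {v : Euc n → ℂ} (hv2 : MemLp v 2) {R : ℝ}
    (hv : ∀ t, R < ‖t‖ → v t = 0) :
    ∑' k : Fin n → ℤ, ‖∫ t, expo k t * v t‖ₑ ^ 2
      = ∫⁻ t in unitCube n, ‖periodization v t‖ₑ ^ 2 := by
  obtain ⟨M, hM, hper⟩ := exists_finset_periodization hv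
  have hw : MemLp (fun t => ∑ k ∈ M, v (t + latt k)) 2 (volume.restrict (unitCube n)) := by
    refine MemLp.restrict _ (memLp_finsetSum _ fun k _ => ?_)
    exact hv2.comp_measurePreserving (measurePreserving_add_right volume (latt k))
  have hint := integrable_of_memLp_two_of_bounded_support hv2 hv
  rw [setLIntegral_congr_fun measurableSet_unitCube fun t ht => by rw [hper t ht],
    ← tsum_enorm_sq_integral_unitCube hw]
  refine tsum_congr fun k => ?_
  rw [integral_eq_integral_unitCube_sum _ M]
  · congr 3
    refine funext fun t => ?_
    rw [Finset.mul_sum]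
    exact Finset.sum_congr rfl fun m _ => by rw [expo_add_latt]; rfl
  · intro t ht m hm
    rw [hM t ht m hm, mul_zero]
  · exact hint.bdd_mul (continuous_expo k).aestronglyMeasurable
      (ae_of_all _ fun t => (norm_expo k t).le)

end Periodization

/-! ### Adjoints of invertible maps, determinants and changes of variables. -/

section AdjointEquiv

variable {n : ℕ}

theorem adj_comp_adj (A C : Euc n ≃L[ℝ] Euc n) : (adj C) ∘L (adj A) = adj (A * C) := by
  unfold adj
  rw [← ContinuousLinearMap.adjoint_comp]
  rfl

theorem adj_one : adj (1 : Euc n ≃L[ℝ] Euc n) = ContinuousLinearMap.id ℝ (Euc n) := by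
  ext1 x
  refine ext_inner_left ℝ fun y => ?_
  rw [adj, ContinuousLinearMap.adjoint_inner_right]
  rfl

/-- The adjoint of an invertible map, as an invertible map. -/
def adjEquiv (A : Euc n ≃L[ℝ] Euc n) : Euc n ≃L[ℝ] Euc n :=
  ContinuousLinearEquiv.equivOfInverse (adj A) (adj A⁻¹)
    (fun x => by
      have h := DFunLike.congr_fun (adj_comp_adj A A⁻¹) x
      rwa [mul_inv_cancel, adj_one] at h)
    (fun x => by
      have h := DFunLike.congr_fun (adj_comp_adj A⁻¹ A) x
      rwa [inv_mul_cancel, adj_one] at h)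

/-- The adjoint as a homomorphism to the opposite group. -/
def adjHom : (Euc n ≃L[ℝ] Euc n) →* (Euc n ≃L[ℝ] Euc n)ᵐᵒᵖ where
  toFun A := MulOpposite.op (adjEquiv A)
  map_one' := by
    refine congrArg MulOpposite.op (ContinuousLinearEquiv.ext (funext fun x => ?_))
    exact DFunLike.congr_fun adj_one x
  map_mul' A C := by
    rw [← MulOpposite.op_mul]
    refine congrArg MulOpposite.op (ContinuousLinearEquiv.ext (funext fun x => ?_))
    exact (DFunLike.congr_fun (adj_comp_adj A C) x).symm

/-- Taking adjoints reverses products, so it is a homomorphism to the opposite group, and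
homomorphisms respect integer powers. -/
theorem adjEquiv_zpow (A : Euc n ≃L[ℝ] Euc n) (j : ℤ) : adjEquiv (A ^ j) = adjEquiv A ^ j :=
  MulOpposite.op_injective ((map_zpow adjHom A j).trans (MulOpposite.op_zpow _ _).symm)

theorem inner_adjEquiv (A : Euc n ≃L[ℝ] Euc n) (x y : Euc n) :
    inner ℝ x (adjEquiv A y) = inner ℝ (A x) y :=
  ContinuousLinearMap.adjoint_inner_right _ _ _

theorem absDet_mul (A C : Euc n ≃L[ℝ] Euc n) : absDet (A * C) = absDet A * absDet C := by
  have h : ((A * C : Euc n ≃L[ℝ] Euc n) : Euc n →ₗ[ℝ] Euc n)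
      = (A : Euc n →ₗ[ℝ] Euc n) ∘ₗ (C : Euc n →ₗ[ℝ] Euc n) := rfl
  rw [absDet, h, LinearMap.det_comp, abs_mul, absDet, absDet]

theorem det_ne_zero (A : Euc n ≃L[ℝ] Euc n) : LinearMap.det (A : Euc n →ₗ[ℝ] Euc n) ≠ 0 :=
  (LinearEquiv.isUnit_det' A.toLinearEquiv).ne_zero

theorem absDet_pos (A : Euc n ≃L[ℝ] Euc n) : 0 < absDet A := abs_pos.2 (det_ne_zero A)

theorem absDet_one : absDet (1 : Euc n ≃L[ℝ] Euc n) = 1 := by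
  have h : ((1 : Euc n ≃L[ℝ] Euc n) : Euc n →ₗ[ℝ] Euc n) = LinearMap.id := rfl
  rw [absDet, h, LinearMap.det_id, abs_one]

theorem absDet_inv (A : Euc n ≃L[ℝ] Euc n) : absDet A⁻¹ = (absDet A)⁻¹ := by
  refine eq_inv_of_mul_eq_one_left ?_
  rw [← absDet_mul, inv_mul_cancel, absDet_one]

theorem absDet_adjEquiv (A : Euc n ≃L[ℝ] Euc n) : absDet (adjEquiv A) = absDet A := by
  have h : ((adjEquiv A : Euc n ≃L[ℝ] Euc n) : Euc n →ₗ[ℝ] Euc n)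
      = LinearMap.adjoint (A : Euc n →ₗ[ℝ] Euc n) := by
    ext1 x
    refine ext_inner_left ℝ fun y => ?_
    rw [LinearMap.adjoint_inner_right]
    exact inner_adjEquiv A y x
  have b := EuclideanSpace.basisFun (Fin n) ℝ
  rw [absDet, absDet, h, ← LinearMap.det_toMatrix b.toBasis, LinearMap.toMatrix_adjoint,
    Matrix.det_conjTranspose, LinearMap.det_toMatrix]
  simp

theorem map_volume_equiv (M : Euc n ≃L[ℝ] Euc n) :
    Measure.map M volume = ENNReal.ofReal (absDet M)⁻¹ • (volume : Measure (Euc n)) := by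
  have h := Measure.map_linearMap_addHaar_eq_smul_addHaar (volume : Measure (Euc n))
    (det_ne_zero M)
  rw [abs_inv] at h
  exact h

theorem quasiMeasurePreserving_equiv (M : Euc n ≃L[ℝ] Euc n) :
    Measure.QuasiMeasurePreserving M (volume : Measure (Euc n)) volume :=
  Measure.LinearMap.quasiMeasurePreserving volume (M : Euc n →ₗ[ℝ] Euc n) (det_ne_zero M)

theorem lintegral_comp_equiv (M : Euc n ≃L[ℝ] Euc n) (f : Euc n → ℝ≥0∞) :
    ENNReal.ofReal (absDet M) * ∫⁻ t, f (M t) = ∫⁻ t, f t := by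
  have h : ∫⁻ t, f (M t) = ∫⁻ t, f t ∂(Measure.map M volume) :=
    (MeasurableEmbedding.lintegral_map M.toHomeomorph.measurableEmbedding f).symm
  rw [h, map_volume_equiv, lintegral_smul_measure, smul_eq_mul, ← mul_assoc,
    ← ENNReal.ofReal_mul (absDet_pos M).le, mul_inv_cancel₀ (absDet_pos M).ne', ENNReal.ofReal_one,
    one_mul]

theorem integral_comp_equiv (M : Euc n ≃L[ℝ] Euc n) (f : Euc n → ℂ) :
    (absDet M : ℂ) * ∫ t, f (M t) = ∫ t, f t := by
  have h : ∫ t, f (M t) = ∫ t, f t ∂(Measure.map M volume) :=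
    (MeasurableEmbedding.integral_map M.toHomeomorph.measurableEmbedding f).symm
  rw [h, map_volume_equiv, integral_smul_measure, ENNReal.toReal_ofReal
    (inv_nonneg.2 (absDet_pos M).le), Complex.real_smul, ← mul_assoc, ← Complex.ofReal_mul,
    mul_inv_cancel₀ (absDet_pos M).ne', Complex.ofReal_one, one_mul]

theorem volume_preimage_equiv (M : Euc n ≃L[ℝ] Euc n) (s : Set (Euc n)) :
    ENNReal.ofReal (absDet M) * volume (M ⁻¹' s) = volume s := by
  have h : volume (M ⁻¹' s) = Measure.map M volume s :=
    (M.toHomeomorph.measurableEmbedding.map_apply volume s).symm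
  rw [h, map_volume_equiv, Measure.smul_apply, smul_eq_mul, ← mul_assoc,
    ← ENNReal.ofReal_mul (absDet_pos M).le, mul_inv_cancel₀ (absDet_pos M).ne', ENNReal.ofReal_one,
    one_mul]

/-- The adjoint of an integral map is integral. -/
theorem exists_adjEquiv_latt {A : Euc n ≃L[ℝ] Euc n}
    (hA : Set.MapsTo A (intLattice n) (intLattice n)) (k : Fin n → ℤ) :
    ∃ m, adjEquiv A (latt k) = latt m := by
  have h (i : Fin n) : ∃ m : Fin n → ℤ, latt m = A (latt (Pi.single i 1)) := hA ⟨_, rfl⟩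
  choose m hm using h
  refine ⟨fun i => ∑ j, m i j * k j, ?_⟩
  ext i
  have h1 : inner ℝ (latt (Pi.single i 1)) (adjEquiv A (latt k)) = adjEquiv A (latt k) i := by
    rw [PiLp.inner_apply, Finset.sum_eq_single i]
    · simp
    · intro j _ hj
      simp [hj]
    · simp
  rw [← h1, inner_adjEquiv, ← hm, inner_latt_latt, latt_apply]

end AdjointEquiv

/-! ### Expansive maps have inverse powers tending to zero. -/

section Expansive

/-- The powers of an element of a complex Banach algebra whose spectrum lies in the open unit disc
tend to zero. -/
theorem tendsto_pow_of_spectrum_lt_one {R : Type*} [NormedRing R] [NormedAlgebra ℂ R]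
    [CompleteSpace R] [Nontrivial R] (a : R) (ha : ∀ z ∈ spectrum ℂ a, ‖z‖₊ < 1) :
    Tendsto (fun j : ℕ => a ^ j) atTop (𝓝 0) := by
  have h := spectrum.pow_norm_pow_one_div_tendsto_nhds_spectralRadius a
  have h1 : spectralRadius ℂ a < (1 : NNReal) := spectrum.spectralRadius_lt_of_forall_lt a ha
  obtain ⟨r, hr1, hr2⟩ := ENNReal.lt_iff_exists_nnreal_btwn.1 h1
  have hr2' : (r : ℝ) < 1 := by exact_mod_cast hr2
  refine squeeze_zero_norm' (a := fun j : ℕ => (r : ℝ) ^ j) ?_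
    (tendsto_pow_atTop_nhds_zero_of_lt_one r.2 hr2')
  filter_upwards [h.eventually (gt_mem_nhds hr1), eventually_gt_atTop 0] with j hj hj0
  have h2 : ‖a ^ j‖ ^ (1 / j : ℝ) ≤ r := by
    have := (ENNReal.ofReal_le_iff_le_toReal ENNReal.coe_ne_top).1 hj.le
    simpa using this
  have h3 : (‖a ^ j‖ ^ (1 / j : ℝ)) ^ j = ‖a ^ j‖ := by
    rw [one_div, Real.rpow_inv_natCast_pow (norm_nonneg _) hj0.ne']
  rw [← h3]
  exact pow_le_pow_left₀ (by positivity) h2 j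

attribute [local instance] Matrix.linftyOpNormedRing Matrix.linftyOpNormedAlgebra

variable {n : ℕ}

/-- The spectral radius formula lives in a complex Banach algebra: the entries are complexified, and
the real powers are recovered by taking real parts. The matrix norm is auxiliary. -/
theorem tendsto_matrix_pow_of_spectrum (hn : 1 ≤ n) (N : Matrix (Fin n) (Fin n) ℝ)
    (hN : ∀ z ∈ spectrum ℂ (N.map (algebraMap ℝ ℂ)), ‖z‖₊ < 1) :
    Tendsto (fun j : ℕ => N ^ j) atTop (𝓝 0) := by
  have : Nonempty (Fin n) := ⟨⟨0, hn⟩⟩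
  have h := tendsto_pow_of_spectrum_lt_one _ hN
  have h2 : Continuous fun M : Matrix (Fin n) (Fin n) ℂ => M.map Complex.re :=
    continuous_id.matrix_map Complex.continuous_re
  have h3 := (h2.tendsto 0).comp h
  have e : ∀ j : ℕ, ((N.map (algebraMap ℝ ℂ)) ^ j).map Complex.re = N ^ j := by
    intro j
    have := (map_pow (algebraMap ℝ ℂ).mapMatrix N j)
    simp only [RingHom.mapMatrix_apply] at this
    rw [← this]
    ext i k
    simp
  have e0 : (0 : Matrix (Fin n) (Fin n) ℂ).map Complex.re = 0 := by ext i k; simp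
  rw [e0] at h3
  exact h3.congr e

theorem tendsto_pow_inv_of_isExpansive (hn : 1 ≤ n) {A : Euc n ≃L[ℝ] Euc n}
    (hA : IsExpansive (A : Euc n →L[ℝ] Euc n)) :
    Tendsto (fun j : ℕ => (((A⁻¹ : Euc n ≃L[ℝ] Euc n) : Euc n →L[ℝ] Euc n)) ^ j)
      atTop (𝓝 0) := by
  let b := (EuclideanSpace.basisFun (Fin n) ℝ).toBasis
  let T : Euc n →ₗ[ℝ] Euc n := (A : Euc n →L[ℝ] Euc n)
  let T' : Euc n →ₗ[ℝ] Euc n := ((A⁻¹ : Euc n ≃L[ℝ] Euc n) : Euc n →L[ℝ] Euc n)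
  have hTT' : T * T' = 1 := by
    ext1 x; exact A.apply_symm_apply x
  have hT'T : T' * T = 1 := by
    ext1 x; exact A.symm_apply_apply x
  let bc := Algebra.TensorProduct.basis ℂ b
  have hspec : ∀ z ∈ spectrum ℂ ((LinearMap.toMatrix b b T').map (algebraMap ℝ ℂ)), ‖z‖₊ < 1 := by
    intro z hz
    rw [← LinearMap.toMatrix_baseChange] at hz
    have hz' : z ∈ spectrum ℂ (T'.baseChange ℂ) := by
      have := AlgEquiv.spectrum_eq (LinearMap.toMatrixAlgEquiv bc) (T'.baseChange ℂ)
      rw [← this]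
      exact hz
    -- The complexification of `A` as a unit with inverse that of `A⁻¹`, so that `z` in the spectrum
    -- of the latter makes `z⁻¹` an eigenvalue of the former.
    let u : (Module.End ℂ (TensorProduct ℝ ℂ (Euc n)))ˣ :=
      ⟨T.baseChange ℂ, T'.baseChange ℂ,
        by rw [← LinearMap.baseChange_mul, hTT', LinearMap.baseChange_one],
        by rw [← LinearMap.baseChange_mul, hT'T, LinearMap.baseChange_one]⟩
    have hz0 : z ≠ 0 := spectrum.ne_zero_of_mem_of_unit (a := u⁻¹) hz'
    have h1 : z⁻¹ ∈ spectrum ℂ (u : Module.End ℂ (TensorProduct ℝ ℂ (Euc n))) :=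
      spectrum.inv₀_mem_iff.2 hz'
    have h2 := hA z⁻¹ (Module.End.hasEigenvalue_iff_mem_spectrum.2 h1)
    rw [norm_inv] at h2
    have h3 : ‖z‖ < 1 := (one_lt_inv₀ (norm_pos_iff.2 hz0)).1 h2
    exact h3
  have hlim := tendsto_matrix_pow_of_spectrum hn _ hspec
  let L : Matrix (Fin n) (Fin n) ℝ →ₗ[ℝ] (Euc n →L[ℝ] Euc n) :=
    (LinearMap.toContinuousLinearMap : (Euc n →ₗ[ℝ] Euc n) ≃ₗ[ℝ] _).toLinearMap ∘ₗ
      (Matrix.toLin b b).toLinearMap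
  have hL : Continuous L := L.continuous_of_finiteDimensional
  have h4 := (hL.tendsto 0).comp hlim
  rw [map_zero] at h4
  refine h4.congr fun j => ?_
  have e : (LinearMap.toMatrix b b T') ^ j = LinearMap.toMatrix b b (T' ^ j) :=
    (map_pow (LinearMap.toMatrixAlgEquiv b) T' j).symm
  ext1 x
  simp only [Function.comp, L, e, LinearMap.comp_apply, LinearEquiv.coe_coe, Matrix.toLin_toMatrix,
    LinearMap.coe_toContinuousLinearMap']
  rw [Module.End.pow_apply, FunLike.coe_pow_eq_iterate]
  rfl

theorem coe_equiv_pow (M : Euc n ≃L[ℝ] Euc n) (j : ℕ) :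
    ((M ^ j : Euc n ≃L[ℝ] Euc n) : Euc n →L[ℝ] Euc n) = (M : Euc n →L[ℝ] Euc n) ^ j := by
  induction j with
  | zero => rfl
  | succ j ih => rw [pow_succ, pow_succ, ← ih]; rfl

/-- `(A*)^{-j}` is the adjoint of `A^{-j}`, and the adjoint preserves the operator norm. -/
theorem tendsto_norm_adjEquiv_inv_pow (hn : 1 ≤ n) {A : Euc n ≃L[ℝ] Euc n}
    (hA : IsExpansive (A : Euc n →L[ℝ] Euc n)) :
    Tendsto (fun j : ℕ => ‖((((adjEquiv A)⁻¹ ^ j : Euc n ≃L[ℝ] Euc n)) : Euc n →L[ℝ] Euc n)‖)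
      atTop (𝓝 0) := by
  have h := (tendsto_pow_inv_of_isExpansive hn hA).norm
  rw [norm_zero] at h
  refine h.congr fun j => ?_
  have e : (adjEquiv A)⁻¹ ^ j = adjEquiv (A⁻¹ ^ j) := by
    have := adjEquiv_zpow A (-j)
    rw [zpow_neg, zpow_natCast, zpow_neg, zpow_natCast, ← inv_pow, ← inv_pow] at this
    exact this.symm
  have e2 : ((adjEquiv (A⁻¹ ^ j) : Euc n ≃L[ℝ] Euc n) : Euc n →L[ℝ] Euc n) = adj (A⁻¹ ^ j) := rfl
  rw [e, e2, adj, LinearIsometryEquiv.norm_map]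
  rw [coe_equiv_pow]

end Expansive

/-! ### The Fourier transform of dilations and translations, and the frame coefficients. -/

section FourierCovariance

variable {n : ℕ}

/-- The dilation `t ↦ |det M|^{1/2} g (M t)` of a function. -/
def dilFun (M : Euc n ≃L[ℝ] Euc n) (g : Euc n → ℂ) (t : Euc n) : ℂ :=
  ((Real.sqrt (absDet M) : ℝ) : ℂ) * g (M t)

theorem coeFn_dilation (M : Euc n ≃L[ℝ] Euc n) (f : L2 n) : dilation M f =ᵐ[volume] dilFun M f :=
  (memLp_dilation M f).coeFn_toLp

theorem enorm_dilFun_sq (M : Euc n ≃L[ℝ] Euc n) (g : Euc n → ℂ) (t : Euc n) :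
    ‖dilFun M g t‖ₑ ^ 2 = ENNReal.ofReal (absDet M) * ‖g (M t)‖ₑ ^ 2 := by
  rw [dilFun, enorm_mul, mul_pow]
  congr 1
  rw [← ofReal_norm, ← ENNReal.ofReal_pow (norm_nonneg _), Complex.norm_real,
    Real.norm_of_nonneg (Real.sqrt_nonneg _), Real.sq_sqrt (absDet_pos M).le]

theorem dilFun_dilFun (M M' : Euc n ≃L[ℝ] Euc n) (g : Euc n → ℂ) :
    dilFun M (dilFun M' g) = dilFun (M' * M) g := by
  funext t
  simp only [dilFun]
  rw [absDet_mul, mul_comm (absDet M'), Real.sqrt_mul (absDet_pos M).le, Complex.ofReal_mul,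
    mul_assoc]
  rfl

theorem enorm_sq_eq_lintegral (f : L2 n) : ‖f‖ₑ ^ 2 = ∫⁻ t, ‖f t‖ₑ ^ 2 := by
  have h := eLpNorm_nnreal_pow_eq_lintegral (p := 2) (f := f) (μ := volume) (by norm_num)
  rw [Lp.enorm_def]
  simpa using h

theorem enorm_dilation (M : Euc n ≃L[ℝ] Euc n) (f : L2 n) : ‖dilation M f‖ₑ = ‖f‖ₑ := by
  have h : ‖dilation M f‖ₑ ^ 2 = ‖f‖ₑ ^ 2 := by
    rw [enorm_sq_eq_lintegral, enorm_sq_eq_lintegral, ← lintegral_comp_equiv M (fun t => ‖f t‖ₑ ^ 2)]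
    rw [← lintegral_const_mul' _ _ ENNReal.ofReal_ne_top]
    refine lintegral_congr_ae ?_
    filter_upwards [coeFn_dilation M f] with t ht
    rw [ht, enorm_dilFun_sq]
  exact (ENNReal.pow_right_strictMono (n := 2) (by norm_num)).injective h

theorem dilation_sub (M : Euc n ≃L[ℝ] Euc n) (f g : L2 n) :
    dilation M (f - g) = dilation M f - dilation M g := by
  apply Lp.ext
  filter_upwards [coeFn_dilation M (f - g), coeFn_dilation M f, coeFn_dilation M g,
    Lp.coeFn_sub (dilation M f) (dilation M g),
    (quasiMeasurePreserving_equiv M).ae (Lp.coeFn_sub f g)] with t h1 h2 h3 h4 h5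
  rw [h1, h4, Pi.sub_apply, h2, h3, dilFun, h5, dilFun, dilFun, Pi.sub_apply, mul_sub]

theorem continuous_dilation (M : Euc n ≃L[ℝ] Euc n) : Continuous (dilation M) := by
  refine Isometry.continuous fun f g => ?_
  rw [edist_eq_enorm_sub, edist_eq_enorm_sub, ← dilation_sub, enorm_dilation]

/-- The character `e^{-2πi b·x}`. -/
def character (b x : Euc n) : ℂ := (Real.fourierChar (-inner ℝ b x) : ℂ)

theorem norm_character (b x : Euc n) : ‖character b x‖ = 1 := Circle.norm_coe _

theorem conj_character_latt (k : Fin n → ℤ) (x : Euc n) :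
    conj (character (latt k) x) = expo k x := by
  rw [character, expo, Real.fourierChar_apply, ← Complex.exp_conj]
  congr 1
  simp only [map_mul, map_neg, Complex.conj_ofReal, Complex.conj_I, Complex.ofReal_neg,
    Complex.ofReal_mul, Complex.ofReal_ofNat, Complex.conj_ofNat]
  ring

theorem continuous_character (b : Euc n) : Continuous (character b) := by
  unfold character
  fun_prop

theorem memLp_character_mul (b : Euc n) (f : L2 n) :
    MemLp (fun x => character b x * f x) 2 volume :=
  (Lp.memLp f).of_le (by
      exact (continuous_character b).aestronglyMeasurable.mul (Lp.aestronglyMeasurable f))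
    (ae_of_all _ fun x => by rw [norm_mul, norm_character, one_mul])

/-- Multiplication by a character on `L²`. -/
def modulation (b : Euc n) (f : L2 n) : L2 n := (memLp_character_mul b f).toLp _

theorem coeFn_modulation (b : Euc n) (f : L2 n) :
    modulation b f =ᵐ[volume] fun x => character b x * f x :=
  (memLp_character_mul b f).coeFn_toLp

theorem continuous_modulation (b : Euc n) : Continuous (modulation b) := by
  refine Isometry.continuous fun f g => ?_
  rw [edist_eq_enorm_sub, edist_eq_enorm_sub]
  refine (ENNReal.pow_right_strictMono (n := 2) (by norm_num)).injective ?_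
  beta_reduce
  rw [enorm_sq_eq_lintegral, enorm_sq_eq_lintegral]
  refine lintegral_congr_ae ?_
  filter_upwards [coeFn_modulation b f, coeFn_modulation b g,
    Lp.coeFn_sub (modulation b f) (modulation b g), Lp.coeFn_sub f g] with t h1 h2 h3 h4
  rw [h3, h4, Pi.sub_apply, Pi.sub_apply, h1, h2, ← mul_sub, enorm_mul, ← ofReal_norm,
    norm_character, ENNReal.ofReal_one, one_mul]

theorem coeFn_fourier_schwartz (s : SchwartzMap (Euc n) ℂ) :
    (𝓕 (s.toLp 2 : L2 n) : L2 n) =ᵐ[volume] 𝓕 (s : Euc n → ℂ) := by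
  rw [SchwartzMap.toLp_fourier_eq]
  exact SchwartzMap.coeFn_toLp _ _ _

theorem continuous_fourier_L2 : Continuous fun f : L2 n => (𝓕 f : L2 n) :=
  (Lp.fourierTransformₗᵢ (Euc n) ℂ).continuous

theorem continuous_translation (b : Euc n) : Continuous (translation b : L2 n → L2 n) :=
  (Lp.isometry_compMeasurePreserving (measurePreserving_sub_right volume b)).continuous

/-- Both sides are continuous in `f`, so it suffices to treat Schwartz functions, where the
transform is an integral and the variable can be shifted. -/
theorem fourier_translation (b : Euc n) (f : L2 n) :
    (𝓕 (translation b f) : L2 n) = modulation b (𝓕 f : L2 n) := by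
  refine DenseRange.induction_on
    (p := fun f : L2 n => (𝓕 (translation b f) : L2 n) = modulation b (𝓕 f : L2 n))
    (SchwartzMap.denseRange_toLpCLM (p := 2) ENNReal.ofNat_ne_top) f ?_ fun s => ?_
  · exact isClosed_eq (continuous_fourier_L2.comp (continuous_translation b))
      ((continuous_modulation b).comp continuous_fourier_L2)
  · simp only [SchwartzMap.toLpCLM_apply]
    have e : translation b (s.toLp 2 : L2 n) = (SchwartzMap.compSubConstCLM ℂ b s).toLp 2 := by
      apply Lp.ext
      have hp := measurePreserving_sub_right (volume : Measure (Euc n)) b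
      filter_upwards [Lp.coeFn_compMeasurePreserving (s.toLp 2 : L2 n) hp,
        SchwartzMap.coeFn_toLp (SchwartzMap.compSubConstCLM ℂ b s) 2 volume,
        hp.quasiMeasurePreserving.ae (SchwartzMap.coeFn_toLp s 2 volume)] with t h1 h2 h3
      rw [translation, h1, h2, Function.comp, h3, SchwartzMap.compSubConstCLM_apply]
    rw [e]
    apply Lp.ext
    filter_upwards [coeFn_fourier_schwartz (SchwartzMap.compSubConstCLM ℂ b s),
      coeFn_fourier_schwartz s, coeFn_modulation b (𝓕 (s.toLp 2 : L2 n) : L2 n)] with x h1 h2 h3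
    rw [h1, h3, h2, Real.fourier_eq, Real.fourier_eq]
    simp only [SchwartzMap.compSubConstCLM_apply, Circle.smul_def, smul_eq_mul]
    rw [← integral_add_right_eq_self _ b, ← integral_const_mul]
    refine integral_congr_ae (ae_of_all _ fun v => ?_)
    simp only [add_sub_cancel_right, character]
    rw [inner_add_left, neg_add, AddChar.map_add_eq_mul, Circle.coe_mul]
    ring

/-- Again by density of Schwartz functions. The substitution `v ↦ A v` contributes `|det A|`, which
turns the factor `|det A|^{-1/2}` into `|det A|^{1/2}`. -/
theorem fourier_dilation (A : Euc n ≃L[ℝ] Euc n) (f : L2 n) :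
    (𝓕 (dilation A f) : L2 n) = dilation (adjEquiv A)⁻¹ (𝓕 f : L2 n) := by
  refine DenseRange.induction_on
    (p := fun f : L2 n => (𝓕 (dilation A f) : L2 n) = dilation (adjEquiv A)⁻¹ (𝓕 f : L2 n))
    (SchwartzMap.denseRange_toLpCLM (p := 2) ENNReal.ofNat_ne_top) f ?_ fun s => ?_
  · exact isClosed_eq (continuous_fourier_L2.comp (continuous_dilation A))
      ((continuous_dilation _).comp continuous_fourier_L2)
  · simp only [SchwartzMap.toLpCLM_apply]
    let s' : SchwartzMap (Euc n) ℂ :=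
      ((Real.sqrt (absDet A) : ℝ) : ℂ) • SchwartzMap.compCLMOfContinuousLinearEquiv ℂ A s
    have hs' (t : Euc n) : s' t = dilFun A s t := rfl
    have e : dilation A (s.toLp 2 : L2 n) = s'.toLp 2 := by
      apply Lp.ext
      filter_upwards [coeFn_dilation A (s.toLp 2 : L2 n), SchwartzMap.coeFn_toLp s' 2 volume,
        (quasiMeasurePreserving_equiv A).ae (SchwartzMap.coeFn_toLp s 2 volume)] with t h1 h2 h3
      rw [h1, h2, hs', dilFun, h3, dilFun]
    rw [e]
    apply Lp.ext
    filter_upwards [coeFn_fourier_schwartz s',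
      coeFn_dilation (adjEquiv A)⁻¹ (𝓕 (s.toLp 2 : L2 n) : L2 n),
      (quasiMeasurePreserving_equiv (adjEquiv A)⁻¹).ae (coeFn_fourier_schwartz s)] with x h1 h2 h3
    rw [h1, h2, dilFun, h3, Real.fourier_eq, Real.fourier_eq]
    simp only [Circle.smul_def, smul_eq_mul, hs', dilFun]
    rw [← integral_comp_equiv A
      (fun v => (Real.fourierChar (-inner ℝ v ((adjEquiv A)⁻¹ x)) : ℂ) * s v), ← mul_assoc, ← integral_const_mul, absDet_inv, absDet_adjEquiv]
    refine integral_congr_ae (ae_of_all _ fun v => ?_)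
    have hi : inner ℝ (A v) ((adjEquiv A)⁻¹ x) = inner ℝ v x := by
      rw [← inner_adjEquiv]
      congr 1
      exact (adjEquiv A).apply_symm_apply x
    simp only [hi]
    have hd : ((Real.sqrt (absDet A)⁻¹ : ℝ) : ℂ) * (absDet A : ℂ)
        = ((Real.sqrt (absDet A) : ℝ) : ℂ) := by
      rw [← Complex.ofReal_mul, Real.sqrt_inv, inv_mul_eq_div, Real.div_sqrt]
    rw [hd]
    ring

theorem inner_eq_integral_ft {f h : L2 n} {g : Euc n → ℂ} (hg : ft f =ᵐ[volume] g) :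
    inner ℂ h f = ∫ t, g t * conj (ft h t) := by
  rw [← Lp.inner_fourier_eq, L2.inner_def]
  refine integral_congr_ae ?_
  filter_upwards [hg] with t ht
  rw [RCLike.inner_apply, ← ht]
  rfl

/-- The frame coefficients on the Fourier side. -/
theorem inner_dilation_translation (A : Euc n ≃L[ℝ] Euc n) (k : Fin n → ℤ) (ψ f : L2 n)
    {g : Euc n → ℂ} (hg : ft f =ᵐ[volume] g) :
    inner ℂ (dilation A (translation (latt k) ψ)) f
      = ∫ t, expo k t * (dilFun (adjEquiv A) g t * conj (ft ψ t)) := by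
  rw [inner_eq_integral_ft hg, ← integral_comp_equiv (adjEquiv A), ← integral_const_mul]
  refine integral_congr_ae ?_
  have h1 : ft (dilation A (translation (latt k) ψ)) =ᵐ[volume]
      dilFun (adjEquiv A)⁻¹ (modulation (latt k) (𝓕 ψ : L2 n)) := by
    rw [ft, fourier_dilation, fourier_translation]
    exact coeFn_dilation _ _
  filter_upwards [(quasiMeasurePreserving_equiv (adjEquiv A)).ae h1,
    coeFn_modulation (latt k) (𝓕 ψ : L2 n)] with t h2 h3
  have e : (adjEquiv A)⁻¹ (adjEquiv A t) = t := (adjEquiv A).symm_apply_apply t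
  rw [h2, dilFun, e, h3, dilFun, absDet_inv, map_mul, map_mul, Complex.conj_ofReal,
    conj_character_latt, ft]
  have hd : (absDet (adjEquiv A) : ℂ) * ((Real.sqrt (absDet (adjEquiv A))⁻¹ : ℝ) : ℂ)
      = ((Real.sqrt (absDet (adjEquiv A)) : ℝ) : ℂ) := by
    rw [← Complex.ofReal_mul, Real.sqrt_inv, ← div_eq_mul_inv, Real.div_sqrt]
  rw [← hd]
  ring

end FourierCovariance

/-! ### Coset representatives and the decomposition of the lattice. -/

section CosetReps

variable {n : ℕ}

/-- A map preserving the integer lattice. -/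
def PreservesLattice (B : Euc n ≃L[ℝ] Euc n) : Prop := ∀ k, ∃ m, B (latt k) = latt m

theorem ae_add {P : Euc n → Prop} (h : ∀ᵐ t, P t) (v : Euc n) : ∀ᵐ t, P (t + v) :=
  (measurePreserving_add_right volume v).quasiMeasurePreserving.ae h

theorem ae_equiv {P : Euc n → Prop} (h : ∀ᵐ t, P t) (M : Euc n ≃L[ℝ] Euc n) : ∀ᵐ t, P (M t) :=
  (quasiMeasurePreserving_equiv M).ae h

/-- `B⁻¹ℤⁿ` is the disjoint union of the cosets `p + ℤⁿ`, `p ∈ Γ`; applying `B` parametrizes `ℤⁿ` by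
`Γ × ℤⁿ`. -/
theorem exists_cosetEquiv {B : Euc n ≃L[ℝ] Euc n} (hB : PreservesLattice B) {Γ : Set (Euc n)}
    (hΓ : IsCosetReps (B : Euc n →L[ℝ] Euc n) Γ) :
    ∃ e : (Γ × (Fin n → ℤ)) ≃ (Fin n → ℤ), ∀ x, latt (e x) = B (x.1 + latt x.2) := by
  have h (x : Γ × (Fin n → ℤ)) : ∃ m, latt m = B (x.1 + latt x.2) := by
    obtain ⟨m₁, h₁⟩ := hΓ.2.1 x.1 x.1.2
    obtain ⟨m₂, h₂⟩ := hB x.2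
    refine ⟨m₁ + m₂, ?_⟩
    rw [latt_add, h₁, map_add, h₂]
    rfl
  choose e he using h
  have hbij : Function.Bijective e := by
    constructor
    · intro x y hxy
      have h1 : (x.1 : Euc n) + latt x.2 = y.1 + latt y.2 := by
        apply B.injective
        rw [← he, ← he, hxy]
      have h2 : (x.1 : Euc n) = y.1 := by
        obtain ⟨p, _, hp⟩ := hΓ.2.2 x.1 (hΓ.2.1 x.1 x.1.2)
        have e1 := hp x.1 ⟨x.1.2, 0, by simp⟩
        have e2 := hp y.1 ⟨y.1.2, y.2 - x.2, by
          rw [latt_sub, sub_eq_sub_iff_add_eq_add, add_comm, ← h1, add_comm]⟩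
        rw [e1, e2]
      have h3 : x.2 = y.2 := latt_injective (by rw [h2] at h1; exact add_left_cancel h1)
      exact Prod.ext (Subtype.ext h2) h3
    · intro m
      have hm : B (B.symm (latt m)) ∈ intLattice n := ⟨m, (B.apply_symm_apply _).symm⟩
      obtain ⟨p, ⟨hp, k, hk⟩, _⟩ := hΓ.2.2 (B.symm (latt m)) hm
      refine ⟨(⟨p, hp⟩, k), latt_injective ?_⟩
      rw [he]
      simp only [hk]
      rw [add_sub_cancel, B.apply_symm_apply]
  exact ⟨Equiv.ofBijective e hbij, he⟩

/-- Integrating the sum over the coset representatives of a periodic function. -/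
theorem lintegral_unitCube_tsum_reps {B : Euc n ≃L[ℝ] Euc n} (hB : PreservesLattice B)
    {Γ : Set (Euc n)} (hΓ : IsCosetReps (B : Euc n →L[ℝ] Euc n) Γ) [Countable Γ]
    {F : Euc n → ℝ≥0∞} (hF : AEMeasurable F (volume.restrict (unitCube n))) (hper : IsPeriodic F) :
    ∫⁻ t in unitCube n, ∑' p : Γ, F (B⁻¹ t + p)
      = ENNReal.ofReal (absDet B) * ∫⁻ t in unitCube n, F t := by
  obtain ⟨e, he⟩ := exists_cosetEquiv hB hΓ
  have hm : AEMeasurable ((unitCube n).indicator F) :=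
    (aemeasurable_indicator_iff measurableSet_unitCube).2 hF
  -- A periodic function is the periodization of its restriction to the cube. This reduces the claim
  -- to unfolding over `ℝⁿ` and a linear change of variables.
  have h1 : ∀ᵐ x : Euc n, F x = ∑' k, (unitCube n).indicator F (x + latt k) := by
    filter_upwards [ae_all_iff.2 hper] with x hx
    have h2 (k : Fin n → ℤ) : (unitCube n).indicator F (x + latt k)
        = (unitCube n).indicator (fun _ => (1 : ℝ≥0∞)) (x - latt (-k)) * F x := by
      rw [latt_neg, sub_neg_eq_add]
      by_cases h : x + latt k ∈ unitCube n <;> simp [h, hx]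
    have h5 := (Equiv.neg (Fin n → ℤ)).tsum_eq
      (fun k => (unitCube n).indicator (fun _ => (1 : ℝ≥0∞)) (x - latt k))
    simp only [Equiv.neg_apply] at h5
    rw [tsum_congr h2, ENNReal.tsum_mul_right, h5, tsum_indicator_unitCube, one_mul]
  have h3 : ∀ᵐ t : Euc n, ∑' p : Γ, F (B⁻¹ t + p)
      = ∑' m, (unitCube n).indicator F (B⁻¹ (t + latt m)) := by
    filter_upwards [ae_all_iff.2 fun p : Γ => ae_equiv (ae_add h1 p) B⁻¹] with t ht
    rw [tsum_congr ht, ← ENNReal.tsum_prod (f := fun (p : Γ) (k : Fin n → ℤ) =>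
      (unitCube n).indicator F (B⁻¹ t + p + latt k)), ← e.tsum_eq]
    refine tsum_congr fun x => ?_
    rw [he, map_add, add_assoc]
    congr 2
    exact (B.symm_apply_apply _).symm
  rw [lintegral_congr_ae (ae_restrict_of_ae h3)]
  have h4 := lintegral_unitCube_tsum (f := fun t => (unitCube n).indicator F (B⁻¹ t))
    (hm.comp_quasiMeasurePreserving (quasiMeasurePreserving_equiv B⁻¹))
  rw [h4, ← lintegral_comp_equiv B, ← lintegral_indicator measurableSet_unitCube]
  congr 1
  refine lintegral_congr fun t => ?_
  congr 1
  exact B.symm_apply_apply t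

theorem volume_unitCube_ne_zero : volume (unitCube n) ≠ 0 := by
  intro h
  have h1 := lintegral_unitCube_tsum (n := n) (f := fun _ => 1) aemeasurable_const
  rw [Measure.restrict_eq_zero.2 h, lintegral_zero_measure, lintegral_one] at h1
  exact (NeZero.ne (volume : Measure (Euc n))) (Measure.measure_univ_eq_zero.1 h1.symm)

/-- Integrating the constant `1` in the preceding identity gives `#Γ · |Q| = |det B| · |Q|` with `0
< |Q| < ∞`, which excludes infinite `Γ`. -/
theorem finite_reps {B : Euc n ≃L[ℝ] Euc n} (hB : PreservesLattice B) {Γ : Set (Euc n)}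
    (hΓ : IsCosetReps (B : Euc n →L[ℝ] Euc n) Γ) : Finite Γ := by
  obtain ⟨e, _⟩ := exists_cosetEquiv hB hΓ
  have : Countable Γ := by
    refine Function.Injective.countable (f := fun p : Γ => e (p, 0)) fun p q h => ?_
    exact congrArg Prod.fst (e.injective h)
  by_contra hinf
  have : Infinite Γ := not_finite_iff_infinite.1 hinf
  have h := lintegral_unitCube_tsum_reps hB hΓ (F := fun _ => 1) aemeasurable_const
    fun k => ae_of_all _ fun _ => rfl
  rw [ENNReal.tsum_const_eq_top_of_ne_zero one_ne_zero, lintegral_const, lintegral_const,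
    Measure.restrict_apply_univ, ENNReal.top_mul volume_unitCube_ne_zero] at h
  have hfin : volume (unitCube n) < ∞ := by
    refine (measure_mono fun t ht => ?_).trans_lt
      (measure_closedBall_lt_top (x := (0 : Euc n)) (r := n))
    exact mem_closedBall_zero_iff.2 (norm_le_of_mem_unitCube ht)
  exact (ENNReal.mul_lt_top ENNReal.ofReal_lt_top (ENNReal.mul_lt_top (by simp) hfin)).ne h.symm

end CosetReps

/-! ### Algebra of one refinement step. -/

section OneStep

variable {n : ℕ}

/-- Bounded measurable functions with bounded support. -/
structure IsTame (G : Euc n → ℂ) : Prop where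
  measurable : Measurable G
  bounded : ∃ C : ℝ, ∀ t, ‖G t‖ ≤ C
  support : ∃ R : ℝ, ∀ t, R < ‖t‖ → G t = 0

theorem IsTame.dilFun {G : Euc n → ℂ} (hG : IsTame G) (M : Euc n ≃L[ℝ] Euc n) :
    IsTame (dilFun M G) := by
  obtain ⟨C, hC⟩ := hG.bounded
  obtain ⟨R, hR⟩ := hG.support
  refine ⟨(hG.measurable.comp M.continuous.measurable).const_mul _,
    ⟨Real.sqrt (absDet M) * C, fun t => ?_⟩,
    ‖((M⁻¹ : Euc n ≃L[ℝ] Euc n) : Euc n →L[ℝ] Euc n)‖ * R, fun t ht => ?_⟩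
  · rw [OEP.dilFun, norm_mul, Complex.norm_real, Real.norm_of_nonneg (Real.sqrt_nonneg _)]
    exact mul_le_mul_of_nonneg_left (hC _) (Real.sqrt_nonneg _)
  · rw [OEP.dilFun, hR, mul_zero]
    by_contra h
    have h1 := ((M⁻¹ : Euc n ≃L[ℝ] Euc n) : Euc n →L[ℝ] Euc n).le_opNorm (M t)
    have h2 : ((M⁻¹ : Euc n ≃L[ℝ] Euc n) : Euc n →L[ℝ] Euc n) (M t) = t := M.symm_apply_apply t
    rw [h2] at h1
    have := mul_le_mul_of_nonneg_left (not_lt.1 h)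
      (norm_nonneg ((M⁻¹ : Euc n ≃L[ℝ] Euc n) : Euc n →L[ℝ] Euc n))
    linarith

theorem IsTame.mul_support {G : Euc n → ℂ} (hG : IsTame G) (χ : Euc n → ℂ) :
    ∃ R : ℝ, ∀ t, R < ‖t‖ → G t * χ t = 0 := by
  obtain ⟨R, hR⟩ := hG.support
  exact ⟨R, fun t ht => by rw [hR t ht, zero_mul]⟩

theorem IsTame.memLp_mul_conj {G : Euc n → ℂ} (hG : IsTame G) {χ : Euc n → ℂ}
    (hχ : MemLp χ 2) : MemLp (fun t => G t * conj (χ t)) 2 := by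
  obtain ⟨C, hC⟩ := hG.bounded
  have h : MemLp (fun t => conj (χ t)) 2 := hχ.of_le
    (Complex.continuous_conj.comp_aestronglyMeasurable hχ.1) (ae_of_all _ fun t => by simp)
  refine h.of_le_mul (c := C) (hG.measurable.aestronglyMeasurable.mul h.1)
    (ae_of_all _ fun t => ?_)
  rw [norm_mul]
  exact mul_le_mul_of_nonneg_right (hC t) (norm_nonneg _)

theorem aestronglyMeasurable_periodization {v : Euc n → ℂ} (hv : AEStronglyMeasurable v)
    (hs : ∃ R : ℝ, ∀ t, R < ‖t‖ → v t = 0) :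
    AEStronglyMeasurable (periodization v) (volume.restrict (unitCube n)) := by
  obtain ⟨R, hR⟩ := hs
  obtain ⟨M, -, hM⟩ := exists_finset_periodization hR
  have h : AEStronglyMeasurable (fun t => ∑ k ∈ M, v (t + latt k))
      (volume.restrict (unitCube n)) := by
    refine AEStronglyMeasurable.restrict (Finset.aestronglyMeasurable_fun_sum _ fun k _ => ?_)
    exact hv.comp_quasiMeasurePreserving
      (measurePreserving_add_right volume (latt k)).quasiMeasurePreserving
  refine h.congr ?_
  filter_upwards [ae_restrict_mem measurableSet_unitCube] with t ht
  exact (hM t ht).symm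

theorem bracket_add_latt (g : Euc n → ℂ) (t : Euc n) (m : Fin n → ℤ) :
    bracket g (t + latt m) = bracket g t := by
  unfold bracket
  rw [← (Equiv.addLeft m).tsum_eq (fun k => ‖g (t + latt k)‖ₑ ^ 2)]
  refine tsum_congr fun k => ?_
  rw [Equiv.coe_addLeft, latt_add, add_assoc]

/-- This is why (b) and (c) are needed only off the zero set of the bracket: on it the correlations
with `φ` vanish. -/
theorem periodization_eq_zero_of_mem_bracketZeros {G φ : Euc n → ℂ} {t : Euc n}
    (ht : t ∈ bracketZeros φ) : periodization (fun t => G t * conj (φ t)) t = 0 := by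
  have h : ∀ k, φ (t + latt k) = 0 := by
    have := ENNReal.tsum_eq_zero.1 ht
    simpa using this
  simp [periodization, h]

/-- Split the lattice sum at `B s` along `B(p + ℤⁿ)`. On each coset the refinement equation applies,
and the periodic mask comes out of the inner sum as `H(s + p)`. -/
theorem periodization_refine {B : Euc n ≃L[ℝ] Euc n} (hB : PreservesLattice B) {Γ : Set (Euc n)}
    (hΓ : IsCosetReps (B : Euc n →L[ℝ] Euc n) Γ) [Fintype Γ] {G : Euc n → ℂ} (hG : IsTame G)
    {φ χ H : Euc n → ℂ} (hH : IsPeriodic H) (hχ : ∀ᵐ t, χ (B t) = H t * φ t) :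
    ∀ᵐ s : Euc n, periodization (fun t => dilFun B⁻¹ G t * conj (χ t)) (B s)
      = ((Real.sqrt (absDet B⁻¹) : ℝ) : ℂ) *
        ∑ p : Γ, conj (H (s + p)) * periodization (fun t => G t * conj (φ t)) (s + p) := by
  obtain ⟨e, he⟩ := exists_cosetEquiv hB hΓ
  have h1 : ∀ᵐ s : Euc n, ∀ x : Γ × (Fin n → ℤ),
      χ (B (s + x.1 + latt x.2)) = H (s + x.1 + latt x.2) * φ (s + x.1 + latt x.2) :=
    ae_all_iff.2 fun x => ae_add (P := fun t => χ (B (t + latt x.2)) = H (t + latt x.2) *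
      φ (t + latt x.2)) (ae_add hχ (latt x.2)) x.1
  have h2 : ∀ᵐ s : Euc n, ∀ x : Γ × (Fin n → ℤ), H (s + x.1 + latt x.2) = H (s + x.1) :=
    ae_all_iff.2 fun x => ae_add (hH x.2) x.1
  filter_upwards [h1, h2] with s hs1 hs2
  have hterm (x : Γ × (Fin n → ℤ)) :
      dilFun B⁻¹ G (B s + latt (e x)) * conj (χ (B s + latt (e x)))
        = ((Real.sqrt (absDet B⁻¹) : ℝ) : ℂ) * (conj (H (s + x.1)) *
          (G (s + x.1 + latt x.2) * conj (φ (s + x.1 + latt x.2)))) := by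
    have e1 : B s + latt (e x) = B (s + x.1 + latt x.2) := by
      rw [he, ← map_add, add_assoc]
    have e2 : B⁻¹ (B (s + x.1 + latt x.2)) = s + x.1 + latt x.2 := B.symm_apply_apply _
    rw [e1, hs1, hs2, dilFun, e2, map_mul]
    ring
  obtain ⟨R, hR⟩ := (hG.dilFun B⁻¹).mul_support fun t => conj (χ t)
  have hsum := (e.summable_iff.2 (summable_add_latt hR (B s)))
  simp only [Function.comp_def] at hsum
  rw [periodization, ← e.tsum_eq, hsum.tsum_prod, tsum_fintype, Finset.mul_sum]
  refine Finset.sum_congr rfl fun p _ => ?_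
  rw [periodization, ← tsum_mul_left, ← tsum_mul_left]
  exact tsum_congr fun k => hterm (p, k)

/-- Expanding the squares gives a Hermitian form in `a` whose kernel is the left side of (b) on the
diagonal and of (c) off it. Entries with a vanishing `a p` or `a q` impose no condition. -/
theorem sum_norm_sq_eq {ι κ : Type*} [Fintype ι] [Fintype κ] (σ : ℝ) (h₀ : ι → ℂ)
    (h : κ → ι → ℂ) (a : ι → ℂ) (s : ι → ℝ)
    (hdiag : ∀ p, a p ≠ 0 → σ * ‖h₀ p‖ ^ 2 + ∑ l, ‖h l p‖ ^ 2 = s p)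
    (hoff : ∀ p q, p ≠ q → a p ≠ 0 → a q ≠ 0 →
      (σ : ℂ) * h₀ q * conj (h₀ p) + ∑ l, h l q * conj (h l p) = 0) :
    σ * ‖∑ p, conj (h₀ p) * a p‖ ^ 2 + ∑ l, ‖∑ p, conj (h l p) * a p‖ ^ 2
      = ∑ p, s p * ‖a p‖ ^ 2 := by
  have hsq (z : ℂ) : (‖z‖ : ℂ) ^ 2 = z * conj z := by
    rw [Complex.mul_conj, Complex.normSq_eq_norm_sq, Complex.ofReal_pow]
  have hexp (g : ι → ℂ) : (‖∑ p, conj (g p) * a p‖ : ℂ) ^ 2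
      = ∑ p, ∑ q, (g q * conj (g p)) * (a p * conj (a q)) := by
    rw [hsq, map_sum, Finset.sum_mul_sum]
    refine Finset.sum_congr rfl fun p _ => Finset.sum_congr rfl fun q _ => ?_
    rw [map_mul, Complex.conj_conj]
    ring
  apply Complex.ofReal_injective
  push_cast
  simp only [hexp]
  rw [Finset.sum_comm (s := (Finset.univ : Finset κ)), Finset.mul_sum, ← Finset.sum_add_distrib]
  refine Finset.sum_congr rfl fun p _ => ?_
  rw [Finset.sum_comm (s := (Finset.univ : Finset κ)), Finset.mul_sum, ← Finset.sum_add_distrib]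
  have hfac (q : ι) : (σ : ℂ) * (h₀ q * conj (h₀ p) * (a p * conj (a q)))
      + ∑ l, h l q * conj (h l p) * (a p * conj (a q))
      = ((σ : ℂ) * h₀ q * conj (h₀ p) + ∑ l, h l q * conj (h l p)) * (a p * conj (a q)) := by
    rw [← Finset.sum_mul]
    ring
  simp only [hfac]
  rw [Finset.sum_eq_single p]
  · by_cases hp : a p = 0
    · simp [hp]
    · rw [← hdiag p hp, hsq]
      congr 1
      push_cast
      simp only [hsq, mul_assoc]
  · intro q _ hq
    by_cases hp : a p = 0
    · simp [hp]
    · by_cases hq0 : a q = 0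
      · simp [hq0]
      · rw [hoff p q hq.symm hp hq0, zero_mul]
  · simp

end OneStep

/-! ### Energy balance between consecutive scales. -/

section OneStepIdentity

variable {n N : ℕ}

/-- The hypotheses of the oblique extension principle on the Fourier side, for the transposed
dilation `B`, except for the one on the behaviour at the origin. -/
structure MaskSystem (B : Euc n ≃L[ℝ] Euc n) (Γ : Set (Euc n)) (φ : Euc n → ℂ) (H₀ : Euc n → ℂ)
    (H : Fin N → Euc n → ℂ) (ψ : Fin N → Euc n → ℂ) (S : Euc n → ℝ) : Prop where
  lattice : PreservesLattice B
  reps : IsCosetReps (B : Euc n →L[ℝ] Euc n) Γ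
  memLp_φ : MemLp φ 2
  memLp_ψ : ∀ l, MemLp (ψ l) 2
  periodic_H₀ : IsPeriodic H₀
  periodic_H : ∀ l, IsPeriodic (H l)
  refine_φ : ∀ᵐ t, φ (B t) = H₀ t * φ t
  refine_ψ : ∀ l, ∀ᵐ t, ψ l (B t) = H l t * φ t
  aemeasurable_S : AEMeasurable S
  nonneg_S : ∀ᵐ t, 0 ≤ S t
  periodic_S : IsPeriodic S
  memLp_sqrt : MemLp (fun t => Real.sqrt (S t) * ‖φ t‖) 2
  diag : ∀ᵐ t, t ∉ bracketZeros φ → S (B t) * ‖H₀ t‖ ^ 2 + ∑ l, ‖H l t‖ ^ 2 = S t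
  offDiag : ∀ p ∈ Γ, p ≠ 0 → ∀ᵐ t, t ∉ bracketZeros φ → t + p ∉ bracketZeros φ →
    (S (B t) : ℂ) * H₀ t * conj (H₀ (t + p)) + ∑ l, H l t * conj (H l (t + p)) = 0

/-- The periodized correlation `∑ₖ G(t + k) conj χ(t + k)`. -/
abbrev correlation (G χ : Euc n → ℂ) : Euc n → ℂ := periodization fun t => G t * conj (χ t)

/-- The energy `∫_Q S |∑ₖ G(· + k) conj φ(· + k)|²`. -/
def energy (S : Euc n → ℝ) (φ G : Euc n → ℂ) : ℝ≥0∞ :=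
  ∫⁻ t in unitCube n, ENNReal.ofReal (S t) * ‖correlation G φ t‖ₑ ^ 2

theorem enorm_sq_eq_ofReal (z : ℂ) : ‖z‖ₑ ^ 2 = ENNReal.ofReal (‖z‖ ^ 2) := by
  rw [ENNReal.ofReal_pow (norm_nonneg _), ofReal_norm]

variable {B : Euc n ≃L[ℝ] Euc n} {Γ : Set (Euc n)} {φ : Euc n → ℂ} {H₀ : Euc n → ℂ}
  {H : Fin N → Euc n → ℂ} {ψ : Fin N → Euc n → ℂ} {S : Euc n → ℝ}

theorem MaskSystem.ae_pointwise (h : MaskSystem B Γ φ H₀ H ψ S) [Fintype Γ] {G : Euc n → ℂ}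
    (hG : IsTame G) :
    ∀ᵐ s : Euc n, S (B s) * ‖correlation (dilFun B⁻¹ G) φ (B s)‖ ^ 2
        + ∑ l, ‖correlation (dilFun B⁻¹ G) (ψ l) (B s)‖ ^ 2
      = absDet B⁻¹ * ∑ p : Γ, S (s + p) * ‖correlation G φ (s + p)‖ ^ 2 := by
  have hφ := periodization_refine h.lattice h.reps hG h.periodic_H₀ h.refine_φ
  have hψ : ∀ᵐ s : Euc n, ∀ l, _ := ae_all_iff.2 fun l =>
    periodization_refine h.lattice h.reps hG (h.periodic_H l) (h.refine_ψ l)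
  -- `B p` is an integer vector, so the weight `S(B ·)` is common to all cosets and serves as the
  -- `σ` of `sum_norm_sq_eq`.
  have hSB : ∀ᵐ s : Euc n, ∀ p : Γ, S (B (s + p)) = S (B s) := by
    refine ae_all_iff.2 fun p => ?_
    obtain ⟨m, hm⟩ := h.reps.2.1 p p.2
    filter_upwards [ae_equiv (h.periodic_S m) B] with s hs
    rw [map_add, ← hs, hm]
    rfl
  have hdiag : ∀ᵐ s : Euc n, ∀ p : Γ, _ := ae_all_iff.2 fun p => ae_add h.diag (p : Euc n)
  -- Cross terms involve differences of representatives, which need not lie in `Γ`, whereas (c)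
  -- concerns elements of `Γ` only. Each difference is replaced by its representative `d x`, at the
  -- cost of a lattice shift `k x` that periodicity absorbs.
  have hdiff : ∀ x : Γ × Γ, ∃ p ∈ Γ, ∃ k, (x.1 : Euc n) - (x.2 : Euc n) = p + latt k := by
    intro x
    have hx : (B : Euc n →L[ℝ] Euc n) ((x.1 : Euc n) - (x.2 : Euc n)) ∈ intLattice n := by
      obtain ⟨m₁, h₁⟩ := h.reps.2.1 x.1 x.1.2
      obtain ⟨m₂, h₂⟩ := h.reps.2.1 x.2 x.2.2
      exact ⟨m₁ - m₂, by rw [latt_sub, map_sub, h₁, h₂]⟩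
    obtain ⟨p, ⟨hp, k, hk⟩, -⟩ := h.reps.2.2 _ hx
    exact ⟨p, hp, k, by rw [hk]; abel⟩
  choose d hdΓ k hk using hdiff
  have hd0 (x : Γ × Γ) (hx : x.1 ≠ x.2) : d x ≠ 0 := by
    intro h0
    refine hx (Subtype.ext ?_)
    obtain ⟨p, -, hp⟩ := h.reps.2.2 x.1 (h.reps.2.1 x.1 x.1.2)
    have e1 := hp x.1 ⟨x.1.2, 0, by simp⟩
    have e2 := hp x.2 ⟨x.2.2, k x, by rw [hk, h0, zero_add]⟩
    rw [e1, e2]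
  have hoff : ∀ᵐ s : Euc n, ∀ x : Γ × Γ, x.1 ≠ x.2 → s + x.2 ∉ bracketZeros φ →
      s + x.2 + d x ∉ bracketZeros φ → (S (B (s + x.2)) : ℂ) * H₀ (s + x.2)
        * conj (H₀ (s + x.2 + d x)) + ∑ l, H l (s + x.2) * conj (H l (s + x.2 + d x)) = 0 := by
    refine ae_all_iff.2 fun x => ?_
    by_cases hx : x.1 = x.2
    · exact ae_of_all _ fun s hs => absurd hx hs
    · filter_upwards [ae_add (h.offDiag (d x) (hdΓ x) (hd0 x hx)) (x.2 : Euc n)] with s hs _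
      exact hs
  have hshift (x : Γ × Γ) (s : Euc n) : s + x.2 + d x + latt (k x) = s + x.1 := by
    rw [add_assoc, ← hk]; abel
  have hH₀ : ∀ᵐ s : Euc n, ∀ x : Γ × Γ, H₀ (s + x.1) = H₀ (s + x.2 + d x) := by
    refine ae_all_iff.2 fun x => ?_
    filter_upwards [ae_add (h.periodic_H₀ (k x)) ((x.2 : Euc n) + d x)] with s hs
    rw [← add_assoc, hshift] at hs
    exact hs
  have hH : ∀ᵐ s : Euc n, ∀ l, ∀ x : Γ × Γ, H l (s + x.1) = H l (s + x.2 + d x) := by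
    refine ae_all_iff.2 fun l => ae_all_iff.2 fun x => ?_
    filter_upwards [ae_add (h.periodic_H l (k x)) ((x.2 : Euc n) + d x)] with s hs
    rw [← add_assoc, hshift] at hs
    exact hs
  filter_upwards [hφ, hψ, hSB, hdiag, hoff, hH₀, hH] with s h1 h2 h3 h4 h5 h6 h7
  have hbr (p : Γ) (hp : correlation G φ (s + p) ≠ 0) : s + p ∉ bracketZeros φ :=
    fun hz => hp (periodization_eq_zero_of_mem_bracketZeros hz)
  have key := sum_norm_sq_eq (S (B s)) (fun p : Γ => H₀ (s + p)) (fun l (p : Γ) => H l (s + p))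
    (fun p : Γ => correlation G φ (s + p)) (fun p : Γ => S (s + p))
    (fun p hp => by
      have := h4 p (hbr p hp)
      rwa [h3 p] at this)
    (fun p q hpq hp hq => by
      have := h5 (p, q) hpq (hbr q hq) (by
        have := hbr p hp
        rw [← hshift (p, q) s] at this
        simpa only [bracketZeros, Set.mem_ofPred_eq, bracket_add_latt] using this)
      rw [← h6 (p, q), h3 q] at this
      rw [← this]
      congr 1
      refine Finset.sum_congr rfl fun l _ => ?_
      rw [← h7 l (p, q)])
  have hc : ‖((Real.sqrt (absDet B⁻¹) : ℝ) : ℂ)‖ ^ 2 = absDet B⁻¹ := by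
    rw [Complex.norm_real, Real.norm_of_nonneg (Real.sqrt_nonneg _),
      Real.sq_sqrt (absDet_pos _).le]
  rw [← key]
  unfold correlation
  simp only [h1, h2, norm_mul, mul_pow, hc]
  rw [← Finset.mul_sum]
  ring

theorem aemeasurable_correlation {G χ : Euc n → ℂ} (hG : IsTame G) (hχ : MemLp χ 2) :
    AEMeasurable (fun t => ‖correlation G χ t‖ₑ ^ 2) (volume.restrict (unitCube n)) :=
  ((aestronglyMeasurable_periodization (hG.memLp_mul_conj hχ).1
    (hG.mul_support _)).enorm).pow_const 2

theorem MaskSystem.aemeasurable_energy (h : MaskSystem B Γ φ H₀ H ψ S) {G : Euc n → ℂ}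
    (hG : IsTame G) :
    AEMeasurable (fun t => ENNReal.ofReal (S t) * ‖correlation G φ t‖ₑ ^ 2)
      (volume.restrict (unitCube n)) :=
  (h.aemeasurable_S.restrict.ennreal_ofReal).mul
    (aemeasurable_correlation hG h.memLp_φ)

/-- Integrate the pointwise identity at `s = B⁻¹ t`. The factor `|det B|⁻¹` from the dilation
cancels the `|det B|` from summing a periodic function over the cosets. -/
theorem MaskSystem.energy_step (h : MaskSystem B Γ φ H₀ H ψ S) {G : Euc n → ℂ} (hG : IsTame G) :
    energy S φ (dilFun B⁻¹ G)
        + ∑ l, ∫⁻ t in unitCube n, ‖correlation (dilFun B⁻¹ G) (ψ l) t‖ₑ ^ 2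
      = energy S φ G := by
  have : Finite Γ := finite_reps h.lattice h.reps
  have : Fintype Γ := Fintype.ofFinite Γ
  have hG' := hG.dilFun B⁻¹
  unfold energy
  rw [← lintegral_finsetSum' _ fun l _ => aemeasurable_correlation hG' (h.memLp_ψ l),
    ← lintegral_add_left' (h.aemeasurable_energy hG')]
  have hpt : ∀ᵐ t : Euc n, ENNReal.ofReal (S t) * ‖correlation (dilFun B⁻¹ G) φ t‖ₑ ^ 2
        + ∑ l, ‖correlation (dilFun B⁻¹ G) (ψ l) t‖ₑ ^ 2
      = ENNReal.ofReal (absDet B⁻¹) * ∑' p : Γ,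
        (ENNReal.ofReal (S (B⁻¹ t + p)) * ‖correlation G φ (B⁻¹ t + p)‖ₑ ^ 2) := by
    have hS : ∀ᵐ t : Euc n, ∀ p : Γ, 0 ≤ S (B⁻¹ t + p) :=
      ae_all_iff.2 fun p => ae_equiv (ae_add h.nonneg_S (p : Euc n)) B⁻¹
    filter_upwards [ae_equiv (h.ae_pointwise hG) B⁻¹, hS, h.nonneg_S] with t ht hSt hSt0
    have e : B (B⁻¹ t) = t := B.apply_symm_apply t
    rw [e] at ht
    rw [tsum_fintype]
    simp only [enorm_sq_eq_ofReal]
    rw [← ENNReal.ofReal_mul hSt0, ← ENNReal.ofReal_sum_of_nonneg fun l _ => by positivity,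
      ← ENNReal.ofReal_add (by positivity) (Finset.sum_nonneg fun l _ => by positivity), ht,
      ENNReal.ofReal_mul (absDet_pos _).le, ENNReal.ofReal_sum_of_nonneg fun p _ =>
        mul_nonneg (hSt p) (by positivity)]
    congr 1
    exact Finset.sum_congr rfl fun p _ => ENNReal.ofReal_mul (hSt p)
  have hW : IsPeriodic fun t => ENNReal.ofReal (S t) * ‖correlation G φ t‖ₑ ^ 2 := by
    intro m
    filter_upwards [h.periodic_S m] with t ht
    rw [ht, correlation, periodization_add_latt]
  rw [lintegral_congr_ae (ae_restrict_of_ae hpt), lintegral_const_mul' _ _ ENNReal.ofReal_ne_top,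
    lintegral_unitCube_tsum_reps h.lattice h.reps (h.aemeasurable_energy hG) hW, ← mul_assoc,
    ← ENNReal.ofReal_mul (absDet_pos _).le, absDet_inv, inv_mul_cancel₀ (absDet_pos _).ne',
    ENNReal.ofReal_one, one_mul]

end OneStepIdentity

/-! ### Limit of the energy at fine scales. -/

section FineScale

variable {n N : ℕ}

theorem inv_pow_apply_pow_apply (B : Euc n ≃L[ℝ] Euc n) (m : ℕ) (x : Euc n) :
    (B⁻¹ ^ m) ((B ^ m) x) = x := by
  rw [inv_pow]
  exact (B ^ m).symm_apply_apply x

theorem pow_apply_inv_pow_apply (B : Euc n ≃L[ℝ] Euc n) (m : ℕ) (x : Euc n) :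
    (B ^ m) ((B⁻¹ ^ m) x) = x := by
  rw [inv_pow]
  exact (B ^ m).apply_symm_apply x

/-- The inverse powers of `B` tend to zero in norm. -/
def InvContracting (B : Euc n ≃L[ℝ] Euc n) : Prop :=
  Tendsto (fun j : ℕ => ‖((B⁻¹ ^ j : Euc n ≃L[ℝ] Euc n) : Euc n →L[ℝ] Euc n)‖) atTop (𝓝 0)

theorem norm_inv_pow_apply_le (B : Euc n ≃L[ℝ] Euc n) (m : ℕ) (x : Euc n) :
    ‖(B⁻¹ ^ m) x‖ ≤ ‖((B⁻¹ ^ m : Euc n ≃L[ℝ] Euc n) : Euc n →L[ℝ] Euc n)‖ * ‖x‖ :=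
  ((B⁻¹ ^ m : Euc n ≃L[ℝ] Euc n) : Euc n →L[ℝ] Euc n).le_opNorm x

/-- `B^{-m}` carries the ball onto the shrunk ball and scales all volumes by one factor, so the
relative volume of the complement of `E` is unchanged. -/
theorem volume_preimage_inv_pow_diff (B : Euc n ≃L[ℝ] Euc n) {E : Set (Euc n)}
    (hE : NullMeasurableSet E volume) {r : ℝ} (hr : 0 < r) (m : ℕ) :
    volume (Metric.ball (0 : Euc n) r ∩ {s | (B⁻¹ ^ m) s ∉ E})
      = volume (Metric.ball (0 : Euc n) r) *
        (1 - volume (E ∩ shrunkBall (B : Euc n →L[ℝ] Euc n) m r 0)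
          / volume (shrunkBall (B : Euc n →L[ℝ] Euc n) m r 0)) := by
  set U := shrunkBall (B : Euc n →L[ℝ] Euc n) m r 0 with hU
  have hUB : U = (B ^ m) ⁻¹' Metric.ball (0 : Euc n) r := by
    ext y
    rw [hU, shrunkBall, Set.mem_ofPred_eq, sub_zero, ← coe_equiv_pow]
    rfl
  have hUV : (B⁻¹ ^ m) ⁻¹' U = Metric.ball (0 : Euc n) r := by
    ext y
    rw [hUB, Set.mem_preimage, Set.mem_preimage, pow_apply_inv_pow_apply]
  have hpre : Metric.ball (0 : Euc n) r ∩ {s | (B⁻¹ ^ m) s ∉ E} = (B⁻¹ ^ m) ⁻¹' (U \ E) := by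
    ext y
    rw [← hUV]
    rfl
  have h1 := volume_preimage_equiv (B⁻¹ ^ m) (U \ E)
  have h2 := volume_preimage_equiv (B⁻¹ ^ m) U
  rw [hUV] at h2
  rw [hpre]
  set c := ENNReal.ofReal (absDet (B⁻¹ ^ m)) with hc
  have hc0 : c ≠ 0 := by simpa [hc] using absDet_pos (B⁻¹ ^ m)
  have hct : c ≠ ∞ := ENNReal.ofReal_ne_top
  have hb0 : volume (Metric.ball (0 : Euc n) r) ≠ 0 := (Metric.measure_ball_pos _ _ hr).ne'
  have hbt : volume (Metric.ball (0 : Euc n) r) ≠ ∞ := measure_ball_lt_top.ne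
  have hU0 : volume U ≠ 0 := by rw [← h2]; exact mul_ne_zero hc0 hb0
  have hUt : volume U ≠ ∞ := by rw [← h2]; exact ENNReal.mul_ne_top hct hbt
  have h3 : volume (U \ E) / volume U = 1 - volume (E ∩ U) / volume U := by
    refine ENNReal.eq_sub_of_add_eq (ENNReal.div_ne_top
      (measure_ne_top_of_subset Set.inter_subset_right hUt) hU0) ?_
    rw [ENNReal.div_add_div_same, add_comm, Set.inter_comm, measure_inter_add_sdiff₀ U hE,
      ENNReal.div_self hU0 hUt]
  rw [← h3]
  have h4 : c * volume ((B⁻¹ ^ m) ⁻¹' (U \ E))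
      = c * (volume (Metric.ball (0 : Euc n) r) * (volume (U \ E) / volume U)) := by
    rw [h1, ← mul_assoc, h2, ENNReal.mul_div_cancel hU0 hUt]
  exact (ENNReal.mul_right_inj hc0 hct).1 h4

/-- For large `m` the points `B^{-m} s` lie close to the origin, so `v(B^{-m} s)` can be far from `v
0` only if `B^{-m} s ∉ E`; density makes the set of such `s` negligible in the limit. -/
theorem tendstoInMeasure_of_isApproxContinuityPoint {B : Euc n ≃L[ℝ] Euc n}
    (hB : InvContracting B) {v : Euc n → ℝ}
    (hv : IsApproxContinuityPoint (B : Euc n →L[ℝ] Euc n) v 0) {r : ℝ} (hr : 0 < r) :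
    TendstoInMeasure (volume.restrict (Metric.ball (0 : Euc n) r))
      (fun (m : ℕ) s => v ((B⁻¹ ^ m) s)) atTop fun _ => v 0 := by
  obtain ⟨E, ⟨hE, -, hdens⟩, hlim⟩ := hv
  intro ε hε
  have h1 : ∀ᶠ y in 𝓝[E] (0 : Euc n), edist (v y) (v 0) < ε :=
    hlim.eventually (Metric.eball_mem_nhds _ hε)
  obtain ⟨δ, hδ, hδE⟩ := Metric.mem_nhdsWithin_iff.1 h1
  have h2 : ∀ᶠ m : ℕ in atTop,
      ‖((B⁻¹ ^ m : Euc n ≃L[ℝ] Euc n) : Euc n →L[ℝ] Euc n)‖ < δ / r :=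
    hB.eventually (gt_mem_nhds (div_pos hδ hr))
  have h3 : Tendsto (fun m : ℕ => volume (Metric.ball (0 : Euc n) r) *
      (1 - volume (E ∩ shrunkBall (B : Euc n →L[ℝ] Euc n) m r 0)
        / volume (shrunkBall (B : Euc n →L[ℝ] Euc n) m r 0))) atTop (𝓝 0) := by
    have h4 := ENNReal.Tendsto.sub (tendsto_const_nhds (x := (1 : ℝ≥0∞))) (hdens r hr)
      (Or.inl ENNReal.one_ne_top)
    have h5 := ENNReal.Tendsto.const_mul (a := volume (Metric.ball (0 : Euc n) r)) h4
      (Or.inr measure_ball_lt_top.ne)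
    simpa using h5
  refine tendsto_of_tendsto_of_tendsto_of_le_of_le' tendsto_const_nhds h3
    (Eventually.of_forall fun _ => zero_le) ?_
  filter_upwards [h2] with m hm
  rw [← volume_preimage_inv_pow_diff B hE hr m, Measure.restrict_apply' measurableSet_ball]
  refine measure_mono fun s hs => ⟨hs.2, fun hsE => ?_⟩
  have h6 : ‖(B⁻¹ ^ m) s‖ < δ := by
    refine (norm_inv_pow_apply_le B m s).trans_lt ?_
    have hsr : ‖s‖ < r := mem_ball_zero_iff.1 hs.2
    calc _ ≤ ‖((B⁻¹ ^ m : Euc n ≃L[ℝ] Euc n) : Euc n →L[ℝ] Euc n)‖ * r :=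
          mul_le_mul_of_nonneg_left hsr.le (norm_nonneg _)
      _ < δ / r * r := mul_lt_mul_of_pos_right hm hr
      _ = δ := div_mul_cancel₀ _ hr.ne'
  have h7 : edist (v ((B⁻¹ ^ m) s)) (v 0) < ε := hδE ⟨mem_ball_zero_iff.2 h6, hsE⟩
  exact absurd hs.1 (not_le.2 h7)

variable {B : Euc n ≃L[ℝ] Euc n} {Γ : Set (Euc n)} {φ : Euc n → ℂ} {H₀ : Euc n → ℂ}
  {H : Fin N → Euc n → ℂ} {ψ : Fin N → Euc n → ℂ} {S : Euc n → ℝ}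

/-- Multiply (b) by `|φ|²` and discard the terms of the masks `H l`; on the bracket zero set `φ`
itself vanishes. -/
theorem MaskSystem.ae_le (h : MaskSystem B Γ φ H₀ H ψ S) :
    ∀ᵐ t : Euc n, S (B t) * ‖φ (B t)‖ ^ 2 ≤ S t * ‖φ t‖ ^ 2 := by
  filter_upwards [h.refine_φ, h.diag] with t h1 h2
  rw [h1, norm_mul, mul_pow, ← mul_assoc]
  by_cases hz : t ∈ bracketZeros φ
  · have := ENNReal.tsum_eq_zero.1 hz 0
    have h0 : φ t = 0 := by simpa using this
    simp [h0]
  · refine mul_le_mul_of_nonneg_right ?_ (by positivity)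
    rw [← h2 hz]
    exact le_add_of_nonneg_right (Finset.sum_nonneg fun l _ => by positivity)

theorem MaskSystem.ae_monotone (h : MaskSystem B Γ φ H₀ H ψ S) :
    ∀ᵐ s : Euc n, Monotone fun m : ℕ => S ((B⁻¹ ^ m) s) * ‖φ ((B⁻¹ ^ m) s)‖ ^ 2 := by
  filter_upwards [ae_all_iff.2 fun m : ℕ => ae_equiv h.ae_le (B⁻¹ ^ (m + 1))] with s hs
  refine monotone_nat_of_le_succ fun m => ?_
  have e : B ((B⁻¹ ^ (m + 1)) s) = (B⁻¹ ^ m) s := by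
    rw [pow_succ']
    exact B.apply_symm_apply _
  have := hs m
  rwa [e] at this

/-- Convergence in measure only yields an almost everywhere convergent subsequence; monotonicity in
`m` promotes it to the full sequence. -/
theorem MaskSystem.ae_tendsto_one (h : MaskSystem B Γ φ H₀ H ψ S) (hn : 1 ≤ n)
    (hB : InvContracting B)
    (ha : IsApproxContinuityPoint (B : Euc n →L[ℝ] Euc n)
      (Function.update (fun t : Euc n => S t * ‖φ t‖ ^ 2) 0 1) 0) :
    ∀ᵐ s : Euc n, Tendsto (fun m : ℕ => S ((B⁻¹ ^ m) s) * ‖φ ((B⁻¹ ^ m) s)‖ ^ 2) atTop (𝓝 1) := by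
  have : Nonempty (Fin n) := ⟨⟨0, hn⟩⟩
  have key (r : ℕ) : ∀ᵐ s : Euc n, s ∈ Metric.ball (0 : Euc n) (r + 1) →
      Tendsto (fun m : ℕ => S ((B⁻¹ ^ m) s) * ‖φ ((B⁻¹ ^ m) s)‖ ^ 2) atTop (𝓝 1) := by
    obtain ⟨ns, hns, hlim⟩ := (tendstoInMeasure_of_isApproxContinuityPoint hB ha
      (r := r + 1) (by positivity)).exists_seq_tendsto_ae
    rw [ae_restrict_iff' measurableSet_ball] at hlim
    filter_upwards [hlim, h.ae_monotone, Measure.ae_ne volume (0 : Euc n)] with s h1 h2 h3 hs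
    rw [tendsto_iff_tendsto_subseq_of_monotone h2 hns.tendsto_atTop]
    have h4 := h1 hs
    rw [Function.update_self] at h4
    refine h4.congr fun m => ?_
    rw [Function.update_of_ne]
    · rfl
    · exact fun h0 => h3 ((map_eq_zero_iff _ (B⁻¹ ^ ns m).injective).1 h0)
  filter_upwards [ae_all_iff.2 key] with s hs
  obtain ⟨r, hr⟩ := exists_nat_gt ‖s‖
  exact hs r (mem_ball_zero_iff.2 (by linarith))

theorem eq_of_norm_add_latt_lt {t : Euc n} {k m : Fin n → ℤ} (hk : ‖t + latt k‖ < 1 / 2)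
    (hm : ‖t + latt m‖ < 1 / 2) : k = m := by
  ext i
  have h1 : ‖latt (k - m)‖ < 1 := by
    have : latt (k - m) = (t + latt k) - (t + latt m) := by rw [latt_sub]; abel
    rw [this]
    exact (norm_sub_le _ _).trans_lt (by linarith)
  have h2 := (PiLp.norm_apply_le (latt (k - m)) i).trans_lt h1
  simp only [latt_apply, Pi.sub_apply, Real.norm_eq_abs] at h2
  have h3 : |k i - m i| < 1 := by exact_mod_cast h2
  have := Int.abs_lt_one_iff.1 h3
  omega

/-- A ball of radius `1/2` meets each coset of `ℤⁿ` at most once, so the square of the correlation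
has no cross terms and the integral unfolds. -/
theorem MaskSystem.energy_eq_of_small_support (h : MaskSystem B Γ φ H₀ H ψ S) {G : Euc n → ℂ}
    (hG : Measurable G) (hs : ∀ t, G t ≠ 0 → ‖t‖ < 1 / 2) :
    energy S φ G = ∫⁻ t, ‖G t‖ₑ ^ 2 * ENNReal.ofReal (S t * ‖φ t‖ ^ 2) := by
  have hm : AEMeasurable fun t => ‖G t‖ₑ ^ 2 * ENNReal.ofReal (S t * ‖φ t‖ ^ 2) :=
    (hG.enorm.pow_const 2).aemeasurable.mul (h.aemeasurable_S.mul
      (h.memLp_φ.1.norm.aemeasurable.pow_const 2)).ennreal_ofReal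
  rw [← lintegral_unitCube_tsum hm, energy]
  refine lintegral_congr_ae (ae_restrict_of_ae ?_)
  filter_upwards [ae_all_iff.2 h.periodic_S, h.nonneg_S] with t h1 h2
  have h3 : ‖correlation G φ t‖ₑ ^ 2
      = ∑' k : Fin n → ℤ, ‖G (t + latt k) * conj (φ (t + latt k))‖ₑ ^ 2 := by
    by_cases hk : ∃ k : Fin n → ℤ, G (t + latt k) ≠ 0
    · obtain ⟨k, hk⟩ := hk
      have hz (m : Fin n → ℤ) (hm : m ≠ k) : G (t + latt m) = 0 := by
        by_contra h0
        exact hm (eq_of_norm_add_latt_lt (hs _ h0) (hs _ hk))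
      rw [correlation, periodization, tsum_eq_single k fun m hm => by rw [hz m hm, zero_mul],
        tsum_eq_single k fun m hm => by rw [hz m hm, zero_mul]; simp]
    · have hz (m : Fin n → ℤ) : G (t + latt m) = 0 := by
        by_contra h0
        exact hk ⟨m, h0⟩
      simp [correlation, periodization, hz]
  rw [h3, ← ENNReal.tsum_mul_left]
  refine tsum_congr fun k => ?_
  rw [h1 k, ENNReal.ofReal_mul h2, ← enorm_sq_eq_ofReal, enorm_mul, mul_pow, RCLike.enorm_conj]
  ring

theorem MaskSystem.tendsto_energy_atTop (h : MaskSystem B Γ φ H₀ H ψ S) (hn : 1 ≤ n)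
    (hB : InvContracting B)
    (ha : IsApproxContinuityPoint (B : Euc n →L[ℝ] Euc n)
      (Function.update (fun t : Euc n => S t * ‖φ t‖ ^ 2) 0 1) 0)
    {g : Euc n → ℂ} (hg : IsTame g) :
    Tendsto (fun m : ℕ => energy S φ (dilFun (B ^ m) g)) atTop (𝓝 (∫⁻ t, ‖g t‖ₑ ^ 2)) := by
  have hmain : Tendsto (fun m : ℕ => ∫⁻ s, ‖g s‖ₑ ^ 2 *
      ENNReal.ofReal (S ((B⁻¹ ^ m) s) * ‖φ ((B⁻¹ ^ m) s)‖ ^ 2)) atTop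
      (𝓝 (∫⁻ t, ‖g t‖ₑ ^ 2)) := by
    refine lintegral_tendsto_of_tendsto_of_monotone (fun m => ?_) ?_ ?_
    · have h1 : AEMeasurable fun t => S t * ‖φ t‖ ^ 2 :=
        h.aemeasurable_S.mul (h.memLp_φ.1.norm.aemeasurable.pow_const 2)
      exact (hg.measurable.enorm.pow_const 2).aemeasurable.mul
        (h1.comp_quasiMeasurePreserving (quasiMeasurePreserving_equiv (B⁻¹ ^ m))).ennreal_ofReal
    · filter_upwards [h.ae_monotone] with s hs
      exact fun i j hij => mul_le_mul_right (ENNReal.ofReal_le_ofReal (hs hij)) _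
    · filter_upwards [h.ae_tendsto_one hn hB ha] with s hs
      have h1 := ENNReal.Tendsto.const_mul (a := ‖g s‖ₑ ^ 2) (ENNReal.tendsto_ofReal hs)
        (Or.inl (by simp))
      simpa using h1
  refine hmain.congr' ?_
  obtain ⟨R, hR⟩ := hg.support
  -- This threshold forces the support of the dilate into the ball of radius `1/2`; `|R| + 1` is a
  -- positive substitute for `R`.
  have h2 : ∀ᶠ m : ℕ in atTop,
      ‖((B⁻¹ ^ m : Euc n ≃L[ℝ] Euc n) : Euc n →L[ℝ] Euc n)‖ < 1 / 2 / (|R| + 1) :=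
    hB.eventually (gt_mem_nhds (by positivity))
  filter_upwards [h2] with m hm
  rw [h.energy_eq_of_small_support (hg.dilFun (B ^ m)).measurable, ← lintegral_comp_equiv (B ^ m),
    ← lintegral_const_mul' _ _ ENNReal.ofReal_ne_top]
  · refine lintegral_congr fun t => ?_
    rw [enorm_dilFun_sq, inv_pow_apply_pow_apply, mul_assoc]
  · intro t ht
    have h3 : g ((B ^ m) t) ≠ 0 := fun h0 => ht (by rw [dilFun, h0, mul_zero])
    have h4 : ‖(B ^ m) t‖ ≤ R := not_lt.1 fun h0 => h3 (hR _ h0)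
    have h5 := norm_inv_pow_apply_le B m ((B ^ m) t)
    rw [inv_pow_apply_pow_apply] at h5
    have hpos : 0 < |R| + 1 := by positivity
    calc ‖t‖ ≤ _ := h5
      _ ≤ ‖((B⁻¹ ^ m : Euc n ≃L[ℝ] Euc n) : Euc n →L[ℝ] Euc n)‖ * (|R| + 1) :=
          mul_le_mul_of_nonneg_left (by linarith [le_abs_self R]) (norm_nonneg _)
      _ < 1 / 2 / (|R| + 1) * (|R| + 1) := mul_lt_mul_of_pos_right hm hpos
      _ = 1 / 2 := div_mul_cancel₀ _ hpos.ne'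

end FineScale

/-! ### Limit of the energy at coarse scales. -/

section CoarseScale

variable {n N : ℕ}

/-- A bound for the sums of `|G|²` over the translates of the lattice, for the dilates `G` of a
tame function to coarse scales. -/
theorem exists_tsum_enorm_sq_dilFun_le {B : Euc n ≃L[ℝ] Euc n} (hB : InvContracting B)
    {g : Euc n → ℂ} (hg : IsTame g) :
    ∃ D : ℝ≥0∞, D ≠ ∞ ∧ ∀ (m : ℕ) (t : Euc n),
      ∑' k : Fin n → ℤ, ‖dilFun (B⁻¹ ^ m) g (t + latt k)‖ₑ ^ 2 ≤ D := by
  obtain ⟨C, hC⟩ := hg.bounded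
  obtain ⟨R, hR⟩ := hg.support
  obtain ⟨c, hc⟩ := hB.bddAbove_range
  have hc' (m : ℕ) : ‖((B⁻¹ ^ m : Euc n ≃L[ℝ] Euc n) : Euc n →L[ℝ] Euc n)‖ ≤ c := hc ⟨m, rfl⟩
  have hc0 : 0 ≤ c := (norm_nonneg _).trans (hc' 0)
  -- `c` bounds all `‖B^{-m}‖` and `n` bounds the norm on the cube, so this ball contains the
  -- support of `g` thickened by the image of the cube under any `B^{-m}`.
  set V := volume (Metric.closedBall (0 : Euc n) (R + c * n)) with hV
  have hVt : V ≠ ∞ := measure_closedBall_lt_top.ne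
  refine ⟨ENNReal.ofReal C ^ 2 * V / volume (unitCube n), ENNReal.div_ne_top
    (ENNReal.mul_ne_top (by simp) hVt) volume_unitCube_ne_zero, fun m t => ?_⟩
  have hq : volume (unitCube n) ≠ ∞ := by
    refine ((measure_mono fun t ht => ?_).trans_lt
      (measure_closedBall_lt_top (x := (0 : Euc n)) (r := n))).ne
    exact mem_closedBall_zero_iff.2 (norm_le_of_mem_unitCube ht)
  rw [ENNReal.le_div_iff_mul_le (Or.inl volume_unitCube_ne_zero) (Or.inl hq)]
  -- A majorant of the summand that tolerates shifts by the cube. Averaging over such shifts turns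
  -- the lattice sum into an integral over `ℝⁿ`, which does not depend on `m`.
  set χ : Euc n → ℝ≥0∞ := fun y =>
    ENNReal.ofReal (absDet (B⁻¹ ^ m)) * (ENNReal.ofReal C ^ 2 *
      (Metric.closedBall (0 : Euc n) (R + c * n)).indicator (fun _ => (1 : ℝ≥0∞)) ((B⁻¹ ^ m) y))
    with hχ
  have hle (y z : Euc n) (hz : z ∈ unitCube n) : ‖dilFun (B⁻¹ ^ m) g y‖ₑ ^ 2 ≤ χ (y + z) := by
    rw [enorm_dilFun_sq]
    refine mul_le_mul_right ?_ _
    by_cases h0 : g ((B⁻¹ ^ m) y) = 0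
    · rw [h0, enorm_zero, zero_pow two_ne_zero]
      exact zero_le
    · have h1 : ‖(B⁻¹ ^ m) y‖ ≤ R := not_lt.1 fun h => h0 (hR _ h)
      have h2 : (B⁻¹ ^ m) (y + z) ∈ Metric.closedBall (0 : Euc n) (R + c * n) := by
        rw [mem_closedBall_zero_iff, map_add]
        refine (norm_add_le _ _).trans (add_le_add h1 ?_)
        exact (norm_inv_pow_apply_le B m z).trans
          (mul_le_mul (hc' m) (norm_le_of_mem_unitCube hz) (norm_nonneg _) hc0)
      rw [Set.indicator_of_mem h2, mul_one]
      refine pow_le_pow_left₀ zero_le ?_ 2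
      rw [← ofReal_norm]
      exact ENNReal.ofReal_le_ofReal (hC _)
  have hχm : Measurable χ := by
    refine ((Measurable.const_mul ?_ _).const_mul _)
    exact (measurable_const.indicator measurableSet_closedBall).comp
      (B⁻¹ ^ m).continuous.measurable
  calc (∑' k : Fin n → ℤ, ‖dilFun (B⁻¹ ^ m) g (t + latt k)‖ₑ ^ 2) * volume (unitCube n)
      = ∫⁻ _z in unitCube n, ∑' k : Fin n → ℤ, ‖dilFun (B⁻¹ ^ m) g (t + latt k)‖ₑ ^ 2 := by
        rw [setLIntegral_const]
    _ ≤ ∫⁻ z in unitCube n, ∑' k : Fin n → ℤ, χ (t + (z + latt k)) := by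
        refine setLIntegral_mono' measurableSet_unitCube fun z hz => ENNReal.tsum_le_tsum fun k => ?_
        have := hle (t + latt k) z hz
        rwa [add_assoc, add_comm (latt k)] at this
    _ = ∫⁻ z, χ (t + z) :=
        lintegral_unitCube_tsum (hχm.comp (measurable_const_add t)).aemeasurable
    _ = ∫⁻ z, χ z := lintegral_add_left_eq_self χ t
    _ = ENNReal.ofReal C ^ 2 * V := by
        rw [hχ, lintegral_const_mul' _ _ ENNReal.ofReal_ne_top,
          lintegral_comp_equiv (B⁻¹ ^ m) (fun y => ENNReal.ofReal C ^ 2 *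
            (Metric.closedBall (0 : Euc n) (R + c * n)).indicator (fun _ => (1 : ℝ≥0∞)) y),
          lintegral_const_mul' _ _ (by simp), lintegral_indicator measurableSet_closedBall,
          lintegral_one, Measure.restrict_apply_univ]

/-- Cauchy-Schwarz for the periodized correlation. -/
theorem enorm_correlation_sq_le {G : Euc n → ℂ} (hG : IsTame G) (φ : Euc n → ℂ) (t : Euc n) :
    ‖correlation G φ t‖ₑ ^ 2 ≤ (∑' k : Fin n → ℤ, ‖G (t + latt k)‖ₑ ^ 2) *
      ∑' k : Fin n → ℤ, {s | G s ≠ 0}.indicator (fun s => ‖φ s‖ₑ ^ 2) (t + latt k) := by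
  obtain ⟨R, hR⟩ := hG.support
  set M := (finite_ne_zero_add_latt hR t).toFinset with hM
  have hmem (k : Fin n → ℤ) : k ∈ M ↔ G (t + latt k) ≠ 0 := by simp [hM]
  have h1 : correlation G φ t = ∑ k ∈ M, G (t + latt k) * conj (φ (t + latt k)) := by
    refine tsum_eq_sum fun k hk => ?_
    rw [hmem, not_not] at hk
    simp only [hk, zero_mul]
  have h2 : ‖correlation G φ t‖ ^ 2
      ≤ (∑ k ∈ M, ‖G (t + latt k)‖ ^ 2) * ∑ k ∈ M, ‖φ (t + latt k)‖ ^ 2 := by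
    rw [h1]
    refine le_trans ?_ (Finset.sum_mul_sq_le_sq_mul_sq M _ _)
    refine pow_le_pow_left₀ (norm_nonneg _) ((norm_sum_le _ _).trans_eq ?_) 2
    exact Finset.sum_congr rfl fun k _ => by rw [norm_mul, RCLike.norm_conj]
  rw [enorm_sq_eq_ofReal]
  refine (ENNReal.ofReal_le_ofReal h2).trans ?_
  rw [ENNReal.ofReal_mul (Finset.sum_nonneg fun _ _ => by positivity),
    ENNReal.ofReal_sum_of_nonneg fun _ _ => by positivity,
    ENNReal.ofReal_sum_of_nonneg fun _ _ => by positivity]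
  refine mul_le_mul' ?_ ?_
  · simp only [← enorm_sq_eq_ofReal]
    exact ENNReal.sum_le_tsum M
  · refine le_trans (Finset.sum_le_sum fun k hk => ?_) (ENNReal.sum_le_tsum M)
    rw [Set.indicator_of_mem (show t + latt k ∈ {s | G s ≠ 0} from (hmem k).1 hk),
      enorm_sq_eq_ofReal]

variable {B : Euc n ≃L[ℝ] Euc n} {Γ : Set (Euc n)} {φ : Euc n → ℂ} {H₀ : Euc n → ℂ}
  {H : Fin N → Euc n → ℂ} {ψ : Fin N → Euc n → ℂ} {S : Euc n → ℝ}

/-- Cauchy-Schwarz, with periodicity used to move `S` inside the lattice sum before unfolding; no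
bound on `S` is required. -/
theorem MaskSystem.energy_le (h : MaskSystem B Γ φ H₀ H ψ S) {G : Euc n → ℂ} (hG : IsTame G)
    {D : ℝ≥0∞} (hDt : D ≠ ∞) (hD : ∀ t, ∑' k : Fin n → ℤ, ‖G (t + latt k)‖ₑ ^ 2 ≤ D) :
    energy S φ G
      ≤ D * ∫⁻ t, {s | G s ≠ 0}.indicator (fun s => ENNReal.ofReal (S s * ‖φ s‖ ^ 2)) t := by
  have hset : MeasurableSet {s | G s ≠ 0} := (measurableSet_eq_fun hG.measurable
    measurable_const).compl
  have hm : AEMeasurable fun t => ENNReal.ofReal (S t * ‖φ t‖ ^ 2) :=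
    (h.aemeasurable_S.mul (h.memLp_φ.1.norm.aemeasurable.pow_const 2)).ennreal_ofReal
  rw [← lintegral_unitCube_tsum (hm.indicator hset), ← lintegral_const_mul' _ _ hDt, energy]
  refine lintegral_mono_ae (ae_restrict_of_ae ?_)
  filter_upwards [ae_all_iff.2 h.periodic_S, h.nonneg_S] with t h1 h2
  calc ENNReal.ofReal (S t) * ‖correlation G φ t‖ₑ ^ 2
      ≤ ENNReal.ofReal (S t) * (D * ∑' k : Fin n → ℤ,
          {s | G s ≠ 0}.indicator (fun s => ‖φ s‖ₑ ^ 2) (t + latt k)) :=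
        mul_le_mul_right ((enorm_correlation_sq_le hG φ t).trans (mul_le_mul_left (hD t) _)) _
    _ = D * ∑' k : Fin n → ℤ, ENNReal.ofReal (S t) *
          {s | G s ≠ 0}.indicator (fun s => ‖φ s‖ₑ ^ 2) (t + latt k) := by
        rw [mul_left_comm, ENNReal.tsum_mul_left]
    _ = _ := by
        congr 1
        refine tsum_congr fun k => ?_
        by_cases hk : t + latt k ∈ {s | G s ≠ 0}
        · rw [Set.indicator_of_mem hk, Set.indicator_of_mem hk, h1 k, ENNReal.ofReal_mul h2,
            enorm_sq_eq_ofReal]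
        · rw [Set.indicator_of_notMem hk, Set.indicator_of_notMem hk, mul_zero]

theorem MaskSystem.lintegral_ne_top (h : MaskSystem B Γ φ H₀ H ψ S) :
    ∫⁻ t, ENNReal.ofReal (S t * ‖φ t‖ ^ 2) ≠ ∞ := by
  have h1 := h.memLp_sqrt.integrable_norm_pow (by norm_num)
  have h2 := h1.lintegral_lt_top.ne
  rwa [lintegral_congr_ae] at h2
  filter_upwards [h.nonneg_S] with t ht
  rw [Real.norm_of_nonneg (by positivity), mul_pow, Real.sq_sqrt ht]

/-- For fixed `t`, `B^{-m} t` eventually enters the ball where `g` vanishes. The indicators thus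
tend to zero pointwise, and the integrable function `S|φ|²` dominates. -/
theorem MaskSystem.tendsto_energy_atBot (h : MaskSystem B Γ φ H₀ H ψ S) (hB : InvContracting B)
    {g : Euc n → ℂ} (hg : IsTame g) {r : ℝ} (hr : 0 < r) (hgr : ∀ t, ‖t‖ < r → g t = 0) :
    Tendsto (fun m : ℕ => energy S φ (dilFun (B⁻¹ ^ m) g)) atTop (𝓝 0) := by
  obtain ⟨D, hDt, hD⟩ := exists_tsum_enorm_sq_dilFun_le hB hg
  have hm : AEMeasurable fun t => ENNReal.ofReal (S t * ‖φ t‖ ^ 2) :=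
    (h.aemeasurable_S.mul (h.memLp_φ.1.norm.aemeasurable.pow_const 2)).ennreal_ofReal
  have hlim : Tendsto (fun m : ℕ => ∫⁻ t, {s | dilFun (B⁻¹ ^ m) g s ≠ 0}.indicator
      (fun s => ENNReal.ofReal (S s * ‖φ s‖ ^ 2)) t) atTop (𝓝 (∫⁻ _t : Euc n, 0)) := by
    refine tendsto_lintegral_of_dominated_convergence' _ (fun m => ?_)
      (fun m => ae_of_all _ fun t => Set.indicator_le_self _ _ t) h.lintegral_ne_top
      (ae_of_all _ fun t => ?_)
    · exact hm.indicator (measurableSet_eq_fun (hg.dilFun _).measurable measurable_const).compl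
    · refine tendsto_const_nhds.congr' ?_
      have h2 : ∀ᶠ m : ℕ in atTop,
          ‖((B⁻¹ ^ m : Euc n ≃L[ℝ] Euc n) : Euc n →L[ℝ] Euc n)‖ < r / (‖t‖ + 1) :=
        hB.eventually (gt_mem_nhds (by positivity))
      filter_upwards [h2] with m hm
      rw [Set.indicator_of_notMem]
      rw [Set.mem_ofPred_eq, not_not, dilFun, hgr, mul_zero]
      have hpos : 0 < ‖t‖ + 1 := by positivity
      calc ‖(B⁻¹ ^ m) t‖ ≤ _ := norm_inv_pow_apply_le B m t
        _ ≤ ‖((B⁻¹ ^ m : Euc n ≃L[ℝ] Euc n) : Euc n →L[ℝ] Euc n)‖ * (‖t‖ + 1) :=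
            mul_le_mul_of_nonneg_left (by linarith) (norm_nonneg _)
        _ < r / (‖t‖ + 1) * (‖t‖ + 1) := mul_lt_mul_of_pos_right hm hpos
        _ = r := div_mul_cancel₀ _ hpos.ne'
  rw [lintegral_zero] at hlim
  have h3 := ENNReal.Tendsto.const_mul (a := D) hlim (Or.inr hDt)
  rw [mul_zero] at h3
  exact tendsto_of_tendsto_of_tendsto_of_le_of_le tendsto_const_nhds h3 (fun _ => zero_le)
    fun m => h.energy_le (hg.dilFun _) hDt (hD m)

end CoarseScale

/-! ### Telescoping over all integer scales. -/

section Telescoping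

/-- Telescoping over `ℤ` in `[0, ∞]`. -/
theorem tsum_int_eq_of_telescoping {K W : ℤ → ℝ≥0∞} {T : ℝ≥0∞}
    (hstep : ∀ j, K j + W j = K (j + 1)) (htop : Tendsto (fun m : ℕ => K m) atTop (𝓝 T))
    (hbot : Tendsto (fun m : ℕ => K (-m)) atTop (𝓝 0)) : ∑' j, W j = T := by
  have h1 (m : ℕ) : K 0 + ∑ i ∈ Finset.range m, W i = K m := by
    induction m with
    | zero => simp
    | succ m ih => rw [Finset.sum_range_succ, ← add_assoc, ih, hstep]; push_cast; rfl
  have h2 (m : ℕ) : K (-m) + ∑ i ∈ Finset.range m, W (-(i + 1)) = K 0 := by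
    induction m with
    | zero => simp
    | succ m ih =>
      rw [Finset.sum_range_succ, add_comm (∑ i ∈ _, _), ← add_assoc]
      have := hstep (-(m + 1))
      rw [show (-((m : ℤ) + 1) + 1) = -m by ring] at this
      push_cast
      rw [this, ih]
  have h3 : K 0 + ∑' i : ℕ, W i = T := by
    refine tendsto_nhds_unique (((ENNReal.tendsto_nat_tsum fun i : ℕ => W i).const_add (K 0)).congr
      h1) htop
  have h4 : 0 + ∑' i : ℕ, W (-(i + 1)) = K 0 := by
    refine tendsto_nhds_unique ((hbot.add
      (ENNReal.tendsto_nat_tsum fun i : ℕ => W (-(i + 1)))).congr h2) tendsto_const_nhds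
  rw [tsum_of_nat_of_neg_add_one ENNReal.summable ENNReal.summable, ← h3, ← h4, zero_add, add_comm]

end Telescoping

/-! ### Reduction to a dense set of functions. -/

section Density

/-- The Parseval identity extends from a dense set to the whole space. -/
theorem isParsevalFrame_of_dense {ι E : Type*} [NormedAddCommGroup E] [InnerProductSpace ℂ E]
    {e : ι → E} {D : Set E} (hD : Dense D)
    (h : ∀ f ∈ D, HasSum (fun i => ‖inner ℂ (e i) f‖ ^ 2) (‖f‖ ^ 2)) : IsParsevalFrame e := by
  have hbessel (f : E) (s : Finset ι) : ∑ i ∈ s, ‖inner ℂ (e i) f‖ ^ 2 ≤ ‖f‖ ^ 2 := by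
    have hc : IsClosed {f : E | ∑ i ∈ s, ‖inner ℂ (e i) f‖ ^ 2 ≤ ‖f‖ ^ 2} :=
      isClosed_le (by fun_prop) (by fun_prop)
    exact closure_minimal (fun g hg => sum_le_hasSum s (fun _ _ => by positivity) (h g hg)) hc
      (hD f)
  have hsum (f : E) : Summable fun i => ‖inner ℂ (e i) f‖ ^ 2 :=
    summable_of_sum_le (fun _ => by positivity) (hbessel f)
  have hle (f : E) : ∑' i, ‖inner ℂ (e i) f‖ ^ 2 ≤ ‖f‖ ^ 2 :=
    (hsum f).tsum_le_of_sum_le (hbessel f)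
  intro f
  set T := ∑' i, ‖inner ℂ (e i) f‖ ^ 2 with hT
  -- Approximate `f` by `g ∈ D`, use `(a + b)² ≤ (1 + δ)a² + (1 + δ⁻¹)b²` termwise, and control the
  -- error by the Bessel bound for `g - f`; at the end `δ → 0`.
  have hge (δ : ℝ) (hδ : 0 < δ) : ‖f‖ ^ 2 ≤ (1 + δ) * T := by
    have hc : IsClosed {g : E | ‖g‖ ^ 2 ≤ (1 + δ) * T + (1 + δ⁻¹) * ‖g - f‖ ^ 2} :=
      isClosed_le (by fun_prop) (by fun_prop)
    have hmem : D ⊆ {g : E | ‖g‖ ^ 2 ≤ (1 + δ) * T + (1 + δ⁻¹) * ‖g - f‖ ^ 2} := by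
      intro g hg
      have hpt (i : ι) : ‖inner ℂ (e i) g‖ ^ 2
          ≤ (1 + δ) * ‖inner ℂ (e i) f‖ ^ 2 + (1 + δ⁻¹) * ‖inner ℂ (e i) (g - f)‖ ^ 2 := by
        set a := ‖inner ℂ (e i) f‖
        set b := ‖inner ℂ (e i) (g - f)‖
        have h1 : ‖inner ℂ (e i) g‖ ≤ a + b := by
          have : inner ℂ (e i) g = inner ℂ (e i) f + inner ℂ (e i) (g - f) := by
            rw [← inner_add_right, add_sub_cancel]
          rw [this]
          exact norm_add_le _ _
        have h2 : ‖inner ℂ (e i) g‖ ^ 2 ≤ (a + b) ^ 2 := pow_le_pow_left₀ (norm_nonneg _) h1 2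
        have h3 : (1 + δ) * a ^ 2 + (1 + δ⁻¹) * b ^ 2 - (a + b) ^ 2 = δ⁻¹ * (δ * a - b) ^ 2 := by
          field_simp
          ring
        have h4 : 0 ≤ δ⁻¹ * (δ * a - b) ^ 2 := by positivity
        linarith
      have h5 := ((hsum f).mul_left (1 + δ)).hasSum.add
        ((hsum (g - f)).mul_left (1 + δ⁻¹)).hasSum
      rw [tsum_mul_left, tsum_mul_left] at h5
      refine (hasSum_le hpt (h g hg) h5).trans ?_
      gcongr
      exact hle _
    have := closure_minimal hmem hc (hD f)
    simpa using this
  have hfin : ‖f‖ ^ 2 ≤ T := by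
    have hlim : Tendsto (fun δ : ℝ => (1 + δ) * T) (𝓝[>] 0) (𝓝 ((1 + 0) * T)) := by
      refine Tendsto.mono_left ?_ nhdsWithin_le_nhds
      exact Continuous.tendsto (by fun_prop) 0
    rw [add_zero, one_mul] at hlim
    refine ge_of_tendsto hlim ?_
    filter_upwards [self_mem_nhdsWithin] with δ hδ
    exact hge δ hδ
  rw [le_antisymm hfin (hle f)]
  exact (hsum f).hasSum

variable {n : ℕ}

/-- Tame functions vanishing near the origin are dense in `L²`. -/
theorem dense_tame (hn : 1 ≤ n) :
    Dense {h : L2 n | ∃ g : Euc n → ℂ, IsTame g ∧ (∃ r : ℝ, 0 < r ∧ ∀ t, ‖t‖ < r → g t = 0) ∧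
      h =ᵐ[volume] g} := by
  have : Nonempty (Fin n) := ⟨⟨0, hn⟩⟩
  intro h
  let X (m : ℕ) : Set (Euc n) := {t | 1 / ((m : ℝ) + 1) ≤ ‖t‖ ∧ ‖t‖ ≤ m ∧ ‖h t‖ ≤ m}
  have hhm : Measurable h := (Lp.stronglyMeasurable h).measurable
  have hX (m : ℕ) : MeasurableSet (X m) :=
    (measurableSet_le measurable_const measurable_norm).inter
      ((measurableSet_le measurable_norm measurable_const).inter
        (measurableSet_le hhm.norm measurable_const))
  have htame (m : ℕ) : IsTame ((X m).indicator h) := by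
    refine ⟨hhm.indicator (hX m), ⟨m, fun t => ?_⟩, ⟨m, fun t ht => ?_⟩⟩
    · by_cases ht : t ∈ X m
      · rw [Set.indicator_of_mem ht]
        exact ht.2.2
      · rw [Set.indicator_of_notMem ht, norm_zero]
        positivity
    · exact Set.indicator_of_notMem (fun hx => (not_le.2 ht) hx.2.1) _
  have hmem (m : ℕ) : MemLp ((X m).indicator h) 2 volume := (Lp.memLp h).indicator (hX m)
  have hlim : Tendsto (fun m : ℕ => ∫⁻ t, (X m)ᶜ.indicator (fun t => ‖h t‖ₑ ^ 2) t) atTop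
      (𝓝 (∫⁻ _t : Euc n, 0)) := by
    refine tendsto_lintegral_of_dominated_convergence' (fun t => ‖h t‖ₑ ^ 2) (fun m => ?_)
      (fun m => ae_of_all _ fun t => Set.indicator_le_self _ _ t) ?_ ?_
    · exact ((hhm.enorm.pow_const 2).indicator (hX m).compl).aemeasurable
    · rw [← enorm_sq_eq_lintegral]
      simp
    · filter_upwards [Measure.ae_ne volume (0 : Euc n)] with t ht
      refine tendsto_const_nhds.congr' ?_
      have h1 : ∀ᶠ m : ℕ in atTop, 1 / ((m : ℝ) + 1) < ‖t‖ :=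
        tendsto_one_div_add_atTop_nhds_zero_nat.eventually (gt_mem_nhds (norm_pos_iff.2 ht))
      have h2 : ∀ᶠ m : ℕ in atTop, ‖t‖ ≤ m := tendsto_natCast_atTop_atTop.eventually_ge_atTop _
      have h3 : ∀ᶠ m : ℕ in atTop, ‖h t‖ ≤ m := tendsto_natCast_atTop_atTop.eventually_ge_atTop _
      filter_upwards [h1, h2, h3] with m h1 h2 h3
      rw [Set.indicator_of_notMem]
      exact fun hx => hx ⟨h1.le, h2, h3⟩
  rw [lintegral_zero] at hlim
  rw [EMetric.mem_closure_iff]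
  intro ε hε
  have hε2 : 0 < ε ^ 2 := by positivity
  obtain ⟨m, hm⟩ := (hlim.eventually (gt_mem_nhds hε2)).exists
  refine ⟨(hmem m).toLp, ⟨_, htame m, ⟨1 / ((m : ℝ) + 1), by positivity, fun t ht => ?_⟩,
    (hmem m).coeFn_toLp⟩, ?_⟩
  · exact Set.indicator_of_notMem (fun hx => (not_le.2 ht) hx.1) _
  · refine (ENNReal.pow_right_strictMono (n := 2) (by norm_num)).lt_iff_lt.1 ?_
    beta_reduce
    rw [edist_eq_enorm_sub, enorm_sq_eq_lintegral]
    refine lt_of_eq_of_lt (lintegral_congr_ae ?_) hm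
    filter_upwards [Lp.coeFn_sub h (hmem m).toLp, (hmem m).coeFn_toLp] with t h1 h2
    rw [h1, Pi.sub_apply, h2]
    by_cases ht : t ∈ X m <;> simp [ht]

end Density

/-! ### Summation over scales, and the theorem. -/

section Main

variable {n N : ℕ} {B : Euc n ≃L[ℝ] Euc n} {Γ : Set (Euc n)} {φ : Euc n → ℂ} {H₀ : Euc n → ℂ}
  {H : Fin N → Euc n → ℂ} {ψ : Fin N → Euc n → ℂ} {S : Euc n → ℝ}

theorem MaskSystem.tsum_eq (h : MaskSystem B Γ φ H₀ H ψ S) (hn : 1 ≤ n)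
    (hB : InvContracting B)
    (ha : IsApproxContinuityPoint (B : Euc n →L[ℝ] Euc n)
      (Function.update (fun t : Euc n => S t * ‖φ t‖ ^ 2) 0 1) 0)
    {g : Euc n → ℂ} (hg : IsTame g) {r : ℝ} (hr : 0 < r) (hgr : ∀ t, ‖t‖ < r → g t = 0) :
    ∑' j : ℤ, ∑ l, ∫⁻ t in unitCube n, ‖correlation (dilFun (B ^ j) g) (ψ l) t‖ₑ ^ 2
      = ∫⁻ t, ‖g t‖ₑ ^ 2 := by
  refine tsum_int_eq_of_telescoping (K := fun j => energy S φ (dilFun (B ^ j) g)) (fun j => ?_)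
    ?_ ?_
  · have h1 := h.energy_step (hg.dilFun (B ^ (j + 1)))
    rwa [dilFun_dilFun, zpow_add_one, mul_inv_cancel_right, ← zpow_add_one] at h1
  · simpa only [zpow_natCast] using h.tendsto_energy_atTop hn hB ha hg
  · simpa only [zpow_neg, zpow_natCast, inv_pow] using h.tendsto_energy_atBot hB hg hr hgr

theorem hasSum_norm_sq_of_tsum_enorm_sq {ι E : Type*} [NormedAddCommGroup E] {a : ι → ℂ} {f : E}
    (h : ∑' i, ‖a i‖ₑ ^ 2 = ‖f‖ₑ ^ 2) : HasSum (fun i => ‖a i‖ ^ 2) (‖f‖ ^ 2) := by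
  have h1 : ∑' i, ‖a i‖ₑ ^ 2 ≠ ∞ := by rw [h]; simp
  have h2 := ENNReal.hasSum_toReal h1
  have h3 : (∑' i, ‖a i‖ₑ ^ 2).toReal = ∑' i, (‖a i‖ₑ ^ 2).toReal :=
    ENNReal.tsum_toReal_eq fun i => ENNReal.ne_top_of_tsum_ne_top h1 i
  rw [← h3, h] at h2
  simpa using h2

end Main

end OEP

end

theorem mainTheorem5 {n N : ℕ} (hn : 1 ≤ n)
    -- the dilation: expansive, mapping the integer lattice into itself
    (A : OEP.Euc n ≃L[ℝ] OEP.Euc n)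
    (hAexp : OEP.IsExpansive (A : OEP.Euc n →L[ℝ] OEP.Euc n))
    (hAint : Set.MapsTo A (OEP.intLattice n) (OEP.intLattice n))
    (Γ : Set (OEP.Euc n)) (hΓ : OEP.IsCosetReps (OEP.adj A) Γ)
    -- the refinable function, its mask, and the functions defined by the other masks
    (φ : OEP.L2 n) (H₀ : OEP.Euc n → ℂ) (hH₀ : OEP.MemLInftyTorus H₀)
    (hφ : ∀ᵐ t : OEP.Euc n, OEP.ft φ (OEP.adj A t) = H₀ t * OEP.ft φ t)
    (H : Fin N → OEP.Euc n → ℂ) (hH : ∀ l, OEP.MemLInftyTorus (H l))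
    (ψ : Fin N → OEP.L2 n)
    (hψ : ∀ l, ∀ᵐ t : OEP.Euc n, OEP.ft (ψ l) (OEP.adj A t) = H l t * OEP.ft φ t)
    -- the function `S`
    (S : OEP.Euc n → ℝ) (hSmeas : AEMeasurable S volume)
    (hSnonneg : ∀ᵐ t : OEP.Euc n, 0 ≤ S t) (hSper : OEP.IsPeriodic S)
    (hSL2 : MemLp (fun t : OEP.Euc n => Real.sqrt (S t) * ‖OEP.ft φ t‖) 2 volume)
    -- (a) approximate continuity at the origin, the value there being set to `1`
    (ha : OEP.IsApproxContinuityPoint (OEP.adj A)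
      (Function.update (fun t : OEP.Euc n => S t * ‖OEP.ft φ t‖ ^ 2) 0 1) 0)
    -- (b)
    (hb : ∀ᵐ t : OEP.Euc n, t ∉ OEP.bracketZeros (OEP.ft φ) →
      S (OEP.adj A t) * ‖H₀ t‖ ^ 2 + ∑ l, ‖H l t‖ ^ 2 = S t)
    -- (c)
    (hc : ∀ p ∈ Γ, p ≠ 0 → ∀ᵐ t : OEP.Euc n,
      t ∉ OEP.bracketZeros (OEP.ft φ) → t + p ∉ OEP.bracketZeros (OEP.ft φ) →
      (S (OEP.adj A t) : ℂ) * H₀ t * conj (H₀ (t + p)) + ∑ l, H l t * conj (H l (t + p)) = 0) :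
    OEP.IsParsevalWaveletFrame A ψ := by
  have hM : OEP.MaskSystem (OEP.adjEquiv A) Γ (OEP.ft φ) H₀ H (fun l => OEP.ft (ψ l)) S :=
    { lattice := OEP.exists_adjEquiv_latt hAint
      reps := hΓ
      memLp_φ := Lp.memLp _
      memLp_ψ := fun l => Lp.memLp _
      periodic_H₀ := hH₀.1
      periodic_H := fun l => (hH l).1
      refine_φ := hφ
      refine_ψ := hψ
      aemeasurable_S := hSmeas
      nonneg_S := hSnonneg
      periodic_S := hSper
      memLp_sqrt := hSL2
      diag := hb
      offDiag := hc }
  -- The Fourier transform is a homeomorphism of `L²`, so the `f` with tame transform vanishing near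
  -- the origin are dense.
  have hdense := (OEP.dense_tame hn).preimage
    (Lp.fourierTransformₗᵢ (OEP.Euc n) ℂ).toHomeomorph.isOpenMap
  refine OEP.isParsevalFrame_of_dense hdense fun f hf => OEP.hasSum_norm_sq_of_tsum_enorm_sq ?_
  obtain ⟨g, hg, ⟨r, hr, hgr⟩, hfg⟩ := hf
  have hfg' : OEP.ft f =ᵐ[volume] g := hfg
  have hnorm : ‖f‖ₑ ^ 2 = ∫⁻ t, ‖g t‖ₑ ^ 2 := by
    have h1 : ‖(𝓕 f : OEP.L2 n)‖ₑ = ‖f‖ₑ := by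
      rw [← ofReal_norm, Lp.norm_fourier_eq, ofReal_norm]
    rw [← h1, OEP.enorm_sq_eq_lintegral]
    refine lintegral_congr_ae ?_
    filter_upwards [hfg'] with t ht
    rw [← ht, OEP.ft]
  rw [hnorm, ← hM.tsum_eq hn (OEP.tendsto_norm_adjEquiv_inv_pow hn hAexp) ha hg hr hgr,
    ENNReal.tsum_prod' (f := fun i : Fin N × ℤ × (Fin n → ℤ) =>
      ‖inner ℂ (OEP.affineSystem A ψ i) f‖ₑ ^ 2), tsum_fintype,
    Summable.tsum_finsetSum fun l _ => ENNReal.summable]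
  refine Finset.sum_congr rfl fun l _ => ?_
  rw [ENNReal.tsum_prod' (f := fun i : ℤ × (Fin n → ℤ) =>
      ‖inner ℂ (OEP.affineSystem A ψ (l, i)) f‖ₑ ^ 2)]
  refine tsum_congr fun j => ?_
  have hG := hg.dilFun (OEP.adjEquiv A ^ j)
  obtain ⟨R, hR⟩ := hG.mul_support fun t => conj (OEP.ft (ψ l) t)
  refine Eq.trans ?_ (OEP.tsum_enorm_sq_integral_expo
    (hG.memLp_mul_conj (χ := OEP.ft (ψ l)) (Lp.memLp _)) hR)
  refine tsum_congr fun k => ?_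
  rw [OEP.affineSystem, OEP.inner_dilation_translation (A ^ j) k (ψ l) f hfg',
    OEP.adjEquiv_zpow]
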